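/- Let $k$ be a global field with separable closure $k_s$, let $p$ be a prime and $e\ge 0$, and let $K_0\subset k_s$ be a cyclic extension of $k$ of degree $p^e$. Let $K_1,\dots,K_m\subset k_s$ be finite extensions of $k$ and $K'=\prod_{i=1}^m K_i$. Let $T=T_{K_0/k}$ be the norm-one torus, $T(R)=\{x\in (K_0\otimes_k R)^\times : N(x)=1\}$. For a field extension $F/k$ write $H^1(F,\widehat T)$ for the first Galois cohomology group of the character group of $T\otimes_k F=T_{(K_0\otimes_k F)/F}$, and for $F'/F$ let $b_{F'/F}\colon H^1(F,\widehat T)\to H^1(F',\widehat T)$ be the base change (restriction) map. Let $\Omega_k$ be the set of places of $k$ and let $$S(K_0,K')=\Big\{x\in\bigoplus_{i=1}^m H^1(K_i,\widehat T) : \forall v\in\Omega_k\ \exists y_v\in H^1(k_v,\widehat T)\ \forall i\ \forall w\mid v \text{ a place of } K_i:\ b_{K_{i,w}/K_i}(x_i)=b_{K_{i,w}/k_v}(y_v)\Big\}.$$ Put $M_i=K_0K_i$, $p^{e_i}=[M_i:K_i]$, $\bar e=\max_i e_i$ ($\bar e=0$ if $m=0$). For $v\in\Omega_k$ let $p^{e(v)}=[K_{0,\tilde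 v}:k_v]$ for any place $\tilde v\mid v$ of $K_0$; for a place $w\mid v$ of $K_i$ let $p^{e_i(w)}=[M_{i,\tilde w}:K_{i,w}]$ for any place $\tilde w\mid w$ of $M_i$; let $e_i(v)=\max_{w\mid v}e_i(w)$. For $a=(a_i)\in\bigoplus_i\mathbb Z/p^{e_i}\mathbb Z$ and $n\in\mathbb Z/p^{\bar e}\mathbb Z$ let $I_n(a)=\{i: n\equiv a_i \bmod p^{e_i}\}$, let $\delta(n,a_i)$ be the largest $r\le e_i$ with $n\equiv a_i \bmod p^r$, and let $\Omega(I_n(a))$ be the set of $v\in\Omega_k$ such that $e_i(w)\le\delta(n,a_i)$ for all $i\notin I_n(a)$ and all places $w\mid v$ of $K_i$. Let $$G(K_0,K')=\Big\{a\in\bigoplus_{i}\mathbb Z/p^{e_i}\mathbb Z : \bigcup_{n\in\mathbb Z/p^{\bar e}\mathbb Z}\Omega(I_n(a))=\Omega_k\Big\}.$$ Call $a$ locally diagonal at $v$ if there is $n\in\mathbb Z/p^{e(v)}\mathbb Z$ with $n\equiv a_i\bmod p^{e_i(v)}$ for all $i$. Let $\gamma\colon \mathrm{Hom}(\mathrm{Gal}(K_0/k),\mathbb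 Q/\mathbb Z)\to\mathbb Z/p^e\mathbb Z$ be an isomorphism, and let $\nu\colon H^1(k,\widehat T)\to \mathrm{Hom}(\mathrm{Gal}(K_0/k),\mathbb Q/\mathbb Z)$ be the natural isomorphism (given by the connecting maps of $0\to\mathbb Z\to\widehat{R_{K_0/k}\mathbb G_m}\to\widehat T\to 0$ and of $0\to\mathbb Z\to\mathbb Q\to\mathbb Q/\mathbb Z\to0$ into $H^2(k,\mathbb Z)$). Then $\gamma$ induces isomorphisms $\Phi_i\colon H^1(K_i,\widehat T)\to\mathbb Z/p^{e_i}\mathbb Z$ with $\Phi_i(b_{K_i/k}(x))=\gamma(\nu(x)) \bmod p^{e_i}$ for all $x\in H^1(k,\widehat T)$, the isomorphism $\bigoplus_i\Phi_i$ maps $S(K_0,K')$ onto $G(K_0,K')$, and $G(K_0,K')$ is the set of all $a\in\bigoplus_i\mathbb Z/p^{e_i}\mathbb Z$ that are locally diagonal at every $v\in\Omega_k$. -/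

import Mathlib

open scoped TensorProduct

universe u

namespace Multinorm

noncomputable section

/-! ### Global fields and places -/

/-- A global field: a number field, or a finite extension of `𝔽_p(t)` for some prime `p`. -/
def IsGlobalField (k : Type u) [Field k] : Prop :=
  NumberField k ∨
    ∃ (p : ℕ) (_ : Fact p.Prime) (_ : Algebra (RatFunc (ZMod p)) k), FunctionField (ZMod p) k

/-- Equivalence of nontrivial real absolute values. -/
def placeSetoid (k : Type u) [Field k] : Setoid {v : AbsoluteValue k ℝ // v.IsNontrivial} where
  r v w := v.1.IsEquiv w.1
  iseqv := ⟨fun _ => .refl _, fun h => h.symm, fun h h' => h.trans h'⟩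

/-- The set `Ω_k` of places of `k`: nontrivial real absolute values up to equivalence. -/
def Place (k : Type u) [Field k] : Type u := Quotient (placeSetoid k)

/-- A chosen absolute value in the class of a place. -/
def Place.abs {k : Type u} [Field k] (v : Place k) : AbsoluteValue k ℝ := (Quotient.out v).1

/-- The absolute values on `L` that restrict to `v` on `F`. If `v` is a nontrivial absolute value
and `L/F` is algebraic, each place of `L` above the place of `v` contains exactly one of them, so
this is the set of places of `L` above `v`. -/
structure PlaceOver {F : Type u} [Field F] (v : AbsoluteValue F ℝ) (L : Type u) [Field L]
    [Algebra F L] where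
  /-- The absolute value. -/
  abs : AbsoluteValue L ℝ
  liesOver : abs.LiesOver v

section Completion

variable {F L : Type u} [Field F] [Field L] [Algebra F L] {v : AbsoluteValue F ℝ}

theorem PlaceOver.isometry (w : PlaceOver v L) :
    Isometry (WithAbs.map v w.abs (algebraMap F L)) := by
  refine AddMonoidHomClass.isometry_of_norm _ fun x => ?_
  rw [WithAbs.norm_eq_apply_ofAbs, WithAbs.norm_eq_apply_ofAbs]
  exact DFunLike.congr_fun w.liesOver.comp_eq x.ofAbs

/-- The map `F_v → L_w` of completions for `w ∣ v`. -/
def PlaceOver.completionMap (w : PlaceOver v L) : v.Completion →+* w.abs.Completion :=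
  w.isometry.mapRingHom

instance PlaceOver.algebraCompletion (w : PlaceOver v L) :
    Algebra v.Completion w.abs.Completion := w.completionMap.toAlgebra

instance PlaceOver.isScalarTower {k : Type u} [Field k] [Algebra k F] [Algebra k L]
    [IsScalarTower k F L] (w : PlaceOver v L) :
    IsScalarTower k v.Completion w.abs.Completion := by
  refine .of_algebraMap_eq fun x => ?_
  change _ = w.completionMap _
  rw [UniformSpace.Completion.algebraMap_def, UniformSpace.Completion.algebraMap_def]
  refine Eq.trans ?_ (w.isometry.mapRingHom_coe _).symm
  simp [WithAbs.algebraMap_right_apply, ← IsScalarTower.algebraMap_apply k F L]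

end Completion

/-! ### The tori `R_{K/k} 𝔾_m` and `T_{K/k}` as group functors, and their characters -/

section Torus

variable (k K : Type u) [Field k] [CommRing K] [Algebra k K]

/-- The map `(R ⊗ K)ˣ → (R' ⊗ K)ˣ` induced by a homomorphism `R → R'` of `k`-algebras. -/
def unitsMap {R R' : Type u} [CommRing R] [Algebra k R] [CommRing R'] [Algebra k R']
    (f : R →ₐ[k] R') : (R ⊗[k] K)ˣ →* (R' ⊗[k] K)ˣ :=
  Units.map (Algebra.TensorProduct.map f (AlgHom.id k K)).toMonoidHom

/-- A group subfunctor of `R ↦ (R ⊗ K)ˣ` on commutative `k`-algebras. -/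
structure GroupFunctor where
  /-- The group of `R`-points. -/
  points : ∀ (R : Type u) [CommRing R] [Algebra k R], Subgroup (R ⊗[k] K)ˣ
  map_mem : ∀ {R R' : Type u} [CommRing R] [Algebra k R] [CommRing R'] [Algebra k R']
    (f : R →ₐ[k] R') (x : (R ⊗[k] K)ˣ), x ∈ points R → unitsMap k K f x ∈ points R'

/-- `T^K = R_{K/k} 𝔾_m`, with `R`-points `(R ⊗ K)ˣ`. -/
def weilTorus : GroupFunctor k K where
  points _ _ _ := ⊤
  map_mem _ _ _ := trivial

variable {k K} in
theorem norm_map [Module.Finite k K] {R R' : Type u} [CommRing R] [Algebra k R] [CommRing R']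
    [Algebra k R'] (f : R →ₐ[k] R') (x : R ⊗[k] K) :
    Algebra.norm R' (Algebra.TensorProduct.map f (AlgHom.id k K) x) = f (Algebra.norm R x) := by
  classical
  let b := Module.finBasis k K
  let B := Algebra.TensorProduct.basis R b
  let B' := Algebra.TensorProduct.basis R' b
  have key : ∀ x : R ⊗[k] K,
      Algebra.leftMulMatrix B' (Algebra.TensorProduct.map f (AlgHom.id k K) x) =
        (Algebra.leftMulMatrix B x).map f := by
    intro x
    induction x with
    | zero => ext; simp
    | add x y hx hy => rw [map_add, map_add, hx, hy, map_add]; ext; simp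
    | tmul r a =>
      ext i j
      simp [Algebra.leftMulMatrix_eq_repr_mul, B, B', Algebra.TensorProduct.basis_apply,
        Algebra.TensorProduct.basis_repr_tmul]
  rw [Algebra.norm_eq_matrix_det B', Algebra.norm_eq_matrix_det B, key]
  exact (f : R →+* R').map_det _ |>.symm

/-- The norm-one torus `T_{K/k}`, with `R`-points the elements of `(R ⊗ K)ˣ` whose norm to `R`
is `1`. -/
def normOneTorus [Module.Finite k K] : GroupFunctor k K where
  points R _ _ := (Units.map (Algebra.norm R : R ⊗[k] K →* R)).ker
  map_mem f x hx := by
    rw [MonoidHom.mem_ker, Units.ext_iff] at hx ⊢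
    have h := norm_map f (x : _ ⊗[k] K)
    simp only [Units.coe_map, Units.val_one] at hx ⊢
    rw [hx, map_one] at h
    exact h

variable {k K}

/-- A character over `Ω` of the group functor `T`: a homomorphism `T_Ω → 𝔾_{m,Ω}` of group
functors on commutative `Ω`-algebras. An `Ω`-algebra is given here as a commutative `k`-algebra `R`
with a `k`-homomorphism `φ : Ω → R`; its homomorphisms are the `k`-homomorphisms under `Ω`. -/
@[ext]
structure Character (T : GroupFunctor k K) (Ω : Type u) [Field Ω] [Algebra k Ω] where
  /-- The homomorphism `T(R) → Rˣ` for the `Ω`-algebra `(R, φ)`. -/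
  app : ∀ (R : Type u) [CommRing R] [Algebra k R], (Ω →ₐ[k] R) → T.points R →* Rˣ
  natural : ∀ {R R' : Type u} [CommRing R] [Algebra k R] [CommRing R'] [Algebra k R']
    (φ : Ω →ₐ[k] R) (f : R →ₐ[k] R') (x : T.points R),
    app R' (f.comp φ) ⟨unitsMap k K f x, T.map_mem f x x.2⟩ =
      Units.map f.toMonoidHom (app R φ x)

namespace Character

variable {T : GroupFunctor k K} {Ω : Type u} [Field Ω] [Algebra k Ω]

instance : Zero (Character T Ω) := ⟨⟨fun _ _ _ _ => 1, fun _ _ _ => by simp⟩⟩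
instance : Add (Character T Ω) :=
  ⟨fun a b => ⟨fun R _ _ φ => a.app R φ * b.app R φ, fun φ f x => by
    simp [a.natural, b.natural]⟩⟩
instance : Neg (Character T Ω) :=
  ⟨fun a => ⟨fun R _ _ φ => (a.app R φ)⁻¹, fun φ f x => by simp [a.natural]⟩⟩

theorem zero_app (R : Type u) [CommRing R] [Algebra k R] (φ : Ω →ₐ[k] R) :
    (0 : Character T Ω).app R φ = 1 := rfl
theorem add_app (a b : Character T Ω) (R : Type u) [CommRing R] [Algebra k R] (φ : Ω →ₐ[k] R) :
    (a + b).app R φ = a.app R φ * b.app R φ := rfl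
theorem neg_app (a : Character T Ω) (R : Type u) [CommRing R] [Algebra k R] (φ : Ω →ₐ[k] R) :
    (-a).app R φ = (a.app R φ)⁻¹ := rfl

/-- The character group `T̂` over `Ω`, written additively. -/
instance : AddCommGroup (Character T Ω) where
  add_assoc a b c := by ext; simp [add_app, mul_assoc]
  zero_add a := by ext; simp [add_app, zero_app]
  add_zero a := by ext; simp [add_app, zero_app]
  neg_add_cancel a := by ext; simp [add_app, neg_app, zero_app]
  add_comm a b := by ext; simp [add_app, mul_comm]
  nsmul := nsmulRec
  zsmul := zsmulRec

/-- Base change of characters along `j : Ω → Ω'`: the restriction of a homomorphism of functors on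
`Ω`-algebras to `Ω'`-algebras. -/
def map {Ω' : Type u} [Field Ω'] [Algebra k Ω'] (j : Ω →ₐ[k] Ω') :
    Character T Ω →+ Character T Ω' where
  toFun χ := ⟨fun R _ _ φ => χ.app R (φ.comp j), fun φ f x => by
    rw [AlgHom.comp_assoc]; exact χ.natural _ _ _⟩
  map_zero' := rfl
  map_add' _ _ := rfl

theorem map_map {Ω' Ω'' : Type u} [Field Ω'] [Algebra k Ω'] [Field Ω''] [Algebra k Ω'']
    (j : Ω →ₐ[k] Ω') (j' : Ω' →ₐ[k] Ω'') (χ : Character T Ω) :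
    map j' (map j χ) = map (j'.comp j) χ := rfl

/-- The action of `Gal(Ω/F)` on characters over `Ω`, `(σχ)(x) = σ(χ(σ⁻¹x))` on `Ω`-points. -/
instance {F : Type u} [Field F] [Algebra k F] [Algebra F Ω] [IsScalarTower k F Ω] :
    DistribMulAction Gal(Ω/F) (Character T Ω) where
  smul σ χ := map ((σ : Ω →ₐ[F] Ω).restrictScalars k) χ
  one_smul _ := rfl
  mul_smul _ _ _ := rfl
  smul_zero _ := rfl
  smul_add _ _ _ := rfl

theorem smul_def {F : Type u} [Field F] [Algebra k F] [Algebra F Ω] [IsScalarTower k F Ω]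
    (σ : Gal(Ω/F)) (χ : Character T Ω) :
    σ • χ = map ((σ : Ω →ₐ[F] Ω).restrictScalars k) χ := rfl

/-- Restriction of characters of `T^K` to the subtorus `T_{K/k}`. -/
def restrictNormOne [Module.Finite k K] (χ : Character (weilTorus k K) Ω) :
    Character (normOneTorus k K) Ω where
  app R _ _ φ := (χ.app R φ).comp (Subgroup.inclusion le_top)
  natural φ f x := χ.natural φ f ⟨x, trivial⟩

/-- The norm `T^K → 𝔾_m` as a character. -/
def normCharacter (k K Ω : Type u) [Field k] [CommRing K] [Algebra k K] [Field Ω] [Algebra k Ω]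
    [Module.Finite k K] : Character (weilTorus k K) Ω where
  app R _ _ _ := (Units.map (Algebra.norm R : R ⊗[k] K →* R)).comp (Subgroup.subtype _)
  natural φ f x := by
    ext
    exact norm_map f (x.1 : _ ⊗[k] K)

end Character

end Torus

/-! ### First cohomology of a topological group with discrete coefficients -/

section H1

variable (Γ : Type*) [Group Γ] [TopologicalSpace Γ] (M : Type*) [AddCommGroup M]
  [DistribMulAction Γ M]

/-- Continuous `1`-cocycles of `Γ` with values in the discrete module `M`. -/
def Z1 : AddSubgroup (Γ → M) where
  carrier := {c | IsLocallyConstant c ∧ ∀ σ τ, c (σ * τ) = c σ + σ • c τ}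
  zero_mem' := ⟨IsLocallyConstant.const 0, fun _ _ => by simp⟩
  add_mem' {a b} ha hb := ⟨ha.1.add hb.1, fun σ τ => by
    simp only [Pi.add_apply, ha.2, hb.2, smul_add]; abel⟩
  neg_mem' {a} ha := ⟨ha.1.neg, fun σ τ => by
    simp only [Pi.neg_apply, ha.2, smul_neg]; abel⟩

/-- The coboundaries `σ ↦ σm - m`. -/
def B1 : AddSubgroup (Γ → M) where
  carrier := {c | ∃ m : M, ∀ σ, c σ = σ • m - m}
  zero_mem' := ⟨0, fun _ => by simp⟩
  add_mem' := by
    rintro a b ⟨m, hm⟩ ⟨n, hn⟩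
    exact ⟨m + n, fun σ => by simp only [Pi.add_apply, hm, hn, smul_add]; abel⟩
  neg_mem' := by
    rintro a ⟨m, hm⟩
    exact ⟨-m, fun σ => by simp only [Pi.neg_apply, hm, smul_neg]; abel⟩

/-- `H¹(Γ, M)`. -/
def H1 : Type _ := Z1 Γ M ⧸ (B1 Γ M).addSubgroupOf (Z1 Γ M)

instance : AddCommGroup (H1 Γ M) :=
  inferInstanceAs (AddCommGroup (Z1 Γ M ⧸ (B1 Γ M).addSubgroupOf (Z1 Γ M)))

variable {Γ M} in
/-- The class of a cocycle. -/
def H1.mk : Z1 Γ M →+ H1 Γ M := QuotientAddGroup.mk' _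

end H1

/-! ### Galois cohomology of the character group of a norm-one torus -/

section Galois

/-- The restriction homomorphism `Γ_{F'} → Γ_F` attached to an extension `F'/F` and an
embedding `j : F_s → F'_s`; it is characterized by `j ∘ (galRestrict j σ) = σ ∘ j`. -/
def galRestrict {F F' : Type u} [Field F] [Field F'] [Algebra F F']
    (j : SeparableClosure F →ₐ[F] SeparableClosure F') :
    Gal(SeparableClosure F'/F') →* Gal(SeparableClosure F/F) :=
  letI := j.toRingHom.toAlgebra
  haveI : IsScalarTower F (SeparableClosure F) (SeparableClosure F') :=
    .of_algebraMap_eq fun x => (j.commutes x).symm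
  (AlgEquiv.restrictNormalHom (SeparableClosure F)).comp (AlgEquiv.restrictScalarsHom F)

theorem galRestrict_commutes {F F' : Type u} [Field F] [Field F'] [Algebra F F']
    (j : SeparableClosure F →ₐ[F] SeparableClosure F') (σ : Gal(SeparableClosure F'/F'))
    (x : SeparableClosure F) : j (galRestrict j σ x) = σ (j x) := by
  let := j.toRingHom.toAlgebra
  have : IsScalarTower F (SeparableClosure F) (SeparableClosure F') :=
    .of_algebraMap_eq fun x => (j.commutes x).symm
  exact AlgEquiv.restrictNormal_commutes (AlgEquiv.restrictScalars F σ) (SeparableClosure F) x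

theorem galRestrict_continuous {F F' : Type u} [Field F] [Field F'] [Algebra F F']
    (j : SeparableClosure F →ₐ[F] SeparableClosure F') : Continuous (galRestrict j) := by
  refine continuous_of_continuousAt_one _ (continuousAt_def.mpr fun A hA => ?_)
  rw [map_one, krullTopology_mem_nhds_one_iff] at hA
  obtain ⟨E, hE, hEA⟩ := hA
  rw [krullTopology_mem_nhds_one_iff]
  obtain ⟨s, hs⟩ := IntermediateField.essFiniteType_iff.1 (inferInstance : Algebra.EssFiniteType F E)
  refine ⟨IntermediateField.adjoin F' (j '' (s : Set (SeparableClosure F))), ?_, fun σ hσ => ?_⟩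
  · have : Finite (j '' (s : Set (SeparableClosure F))) := (s.finite_toSet.image j).to_subtype
    exact IntermediateField.finiteDimensional_adjoin fun x _ =>
      Algebra.IsIntegral.isIntegral (R := F') x
  · refine hEA ?_
    rw [SetLike.mem_coe, ← hs, IntermediateField.mem_fixingSubgroup_iff]
    have hle : IntermediateField.adjoin F (s : Set (SeparableClosure F)) ≤
        IntermediateField.fixedField (Subgroup.zpowers (galRestrict j σ)) := by
      rw [IntermediateField.adjoin_le_iff]
      intro x hx
      have h1 : galRestrict j σ x = x := by
        apply (j : SeparableClosure F →+* SeparableClosure F').injective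
        change j _ = j _
        rw [galRestrict_commutes]
        exact (IntermediateField.mem_fixingSubgroup_iff _ _).1 hσ _
          (IntermediateField.subset_adjoin _ _ ⟨x, hx, rfl⟩)
      rintro ⟨g, hg⟩
      change g x = x
      have hz : Subgroup.zpowers (galRestrict j σ) ≤
          MulAction.stabilizer Gal(SeparableClosure F/F) x := by
        rw [Subgroup.zpowers_le]; exact h1
      exact hz hg
    intro x hx
    exact (hle hx) ⟨_, Subgroup.mem_zpowers _⟩

theorem isScalarTower_sepClosure (k F F' : Type u) [Field k] [Field F] [Algebra k F] [Field F']
    [Algebra k F'] [Algebra F F'] [IsScalarTower k F F'] :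
    IsScalarTower k F (SeparableClosure F') := .of_algebraMap_eq fun x => by
  rw [IsScalarTower.algebraMap_apply k F' (SeparableClosure F'),
    IsScalarTower.algebraMap_apply F F' (SeparableClosure F'),
    IsScalarTower.algebraMap_apply k F F']

theorem map_galRestrict_smul {k K F F' : Type u} [Field k] [CommRing K] [Algebra k K] [Field F]
    [Algebra k F] [Field F'] [Algebra k F'] [Algebra F F'] [IsScalarTower k F F']
    [IsScalarTower k F (SeparableClosure F')] {T : GroupFunctor k K}
    (j : SeparableClosure F →ₐ[F] SeparableClosure F') (σ : Gal(SeparableClosure F'/F'))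
    (χ : Character T (SeparableClosure F)) :
    Character.map (j.restrictScalars k) (galRestrict j σ • χ) =
      σ • Character.map (j.restrictScalars k) χ := by
  rw [Character.smul_def, Character.smul_def, Character.map_map, Character.map_map]
  have h : (j.restrictScalars k).comp
      (((galRestrict j σ : Gal(SeparableClosure F/F)) :
        SeparableClosure F →ₐ[F] SeparableClosure F).restrictScalars k) =
      ((σ : SeparableClosure F' →ₐ[F'] SeparableClosure F').restrictScalars k).comp
        (j.restrictScalars k) := AlgHom.ext fun x => galRestrict_commutes j σ x
  rw [h]

variable (k K F : Type u) [Field k] [CommRing K] [Algebra k K] [Module.Finite k K]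
  [Field F] [Algebra k F]

/-- The character group of `T_{K/k} ⊗_k F` over `F_s`. Since
`R ⊗_F (F ⊗_k K) = R ⊗_k K` for every `F`-algebra `R`, this torus is `T_{(K ⊗_k F)/F}`. -/
abbrev CharGroup : Type _ := Character (normOneTorus k K) (SeparableClosure F)

/-- `H¹(F, T̂_{(K ⊗_k F)/F})`, the first Galois cohomology group of `Γ_F`. -/
def GalH1 : Type _ := H1 Gal(SeparableClosure F/F) (CharGroup k K F)

instance : AddCommGroup (GalH1 k K F) :=
  inferInstanceAs (AddCommGroup (H1 Gal(SeparableClosure F/F) (CharGroup k K F)))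

variable {k F}

/-- The map on cocycles attached to `F'/F` and an embedding `j : F_s → F'_s`. -/
def baseChangeZ1 {F' : Type u} [Field F'] [Algebra k F'] [Algebra F F'] [IsScalarTower k F F']
    (j : SeparableClosure F →ₐ[F] SeparableClosure F') :
    Z1 Gal(SeparableClosure F/F) (CharGroup k K F) →+
      Z1 Gal(SeparableClosure F'/F') (CharGroup k K F') :=
  haveI := isScalarTower_sepClosure k F F'
  { toFun c := ⟨fun σ => Character.map (j.restrictScalars k) (c.1 (galRestrict j σ)),
      (c.2.1.comp_continuous (galRestrict_continuous j)).comp _, fun σ τ => by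
        beta_reduce
        rw [map_mul, c.2.2, map_add, map_galRestrict_smul]⟩
    map_zero' := by ext1; funext σ; exact map_zero _
    map_add' a b := by ext1; funext σ; exact map_add _ _ _ }

/-- The base change map `b_{F'/F} : H¹(F, T̂) → H¹(F', T̂)`. It does not depend on the embedding
`F_s → F'_s` over `F`, and one is chosen. -/
def baseChange (F F' : Type u) [Field F] [Algebra k F] [Field F'] [Algebra k F'] [Algebra F F']
    [IsScalarTower k F F'] : GalH1 k K F →+ GalH1 k K F' :=
  QuotientAddGroup.map _ _ (baseChangeZ1 K (F := F) (F' := F') IsSepClosed.lift) (by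
    rintro c ⟨m, hm⟩
    have := isScalarTower_sepClosure k F F'
    generalize (IsSepClosed.lift : SeparableClosure F →ₐ[F] SeparableClosure F') = j
    refine ⟨Character.map (j.restrictScalars k) m, fun σ => ?_⟩
    have hm' : c.1 (galRestrict j σ) = galRestrict j σ • m - m := hm _
    change Character.map (j.restrictScalars k) (c.1 (galRestrict j σ)) = _
    rw [hm', map_sub, map_galRestrict_smul])

end Galois

/-! ### The group `S(K, K')` -/

section Selmer

variable (k K : Type u) [Field k] [CommRing K] [Algebra k K] [Module.Finite k K]
  {ι : Type*} (K' : ι → Type u) [∀ i, Field (K' i)] [∀ i, Algebra k (K' i)]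

/-- `S(K, K')` for `K' = ∏ K' i`; here `GalH1 k K F` is `H¹(F, T̂_{(K ⊗ F)/F})`, the localization
maps are base change maps, and so are the components of `ι¹` (the dual of the norm
`R_{K'/k}(T_{(K ⊗ K')/K'}) → T_{K/k}` followed by Shapiro's isomorphism). It consists of the elements of `⊕ᵢ H¹(K' i, T̂)` whose image in
`∏_v ⊕ᵢ ⊕_{w ∣ v} H¹((K' i)_w, T̂)` comes from `∏_v H¹(k_v, T̂)`. -/
def selmerGroup : AddSubgroup (∀ i, GalH1 k K (K' i)) where
  carrier := {x | ∃ y : ∀ v : Place k, GalH1 k K v.abs.Completion,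
    ∀ (v : Place k) (i : ι) (w : PlaceOver v.abs (K' i)),
      baseChange K (K' i) w.abs.Completion (x i) =
        baseChange K v.abs.Completion w.abs.Completion (y v)}
  zero_mem' := ⟨0, fun v i w => by simp only [Pi.zero_apply, map_zero]⟩
  add_mem' := by
    rintro a b ⟨y, hy⟩ ⟨z, hz⟩
    exact ⟨y + z, fun v i w => by simp only [Pi.add_apply, map_add, hy, hz]⟩
  neg_mem' := by
    rintro a ⟨y, hy⟩
    exact ⟨-y, fun v i w => by simp only [Pi.neg_apply, map_neg, hy]⟩

end Selmer

/-! ### The natural isomorphism `H¹(k, T̂_{K/k}) ≃ Hom(Gal(K/k), ℚ/ℤ)` -/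

/-- For `K/k` Galois, `x ∈ H¹(k, T̂_{K/k})` and `χ ∈ Hom(Gal(K/k), ℚ/ℤ)`: the connecting map
`H¹(k, T̂_{K/k}) → H²(k, ℤ)` of `0 → ℤ → T̂^K → T̂_{K/k} → 0` (where `1 ∈ ℤ` goes to the norm) and
the connecting map `H¹(k, ℚ/ℤ) → H²(k, ℤ)` of `0 → ℤ → ℚ → ℚ/ℤ → 0` send `x` and the inflation of
`χ` to the same class. This is spelled out on cochains: `x` is the class of a cocycle `c`, which
lifts to `b`, and `χ` lifts to `ψ`, such that `b` and `ψ` have the same coboundary `z`. -/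
def CorrespondsTo {k : Type u} [Field k] (K : IntermediateField k (SeparableClosure k))
    [FiniteDimensional k K] [Normal k K] (x : GalH1 k K k)
    (χ : Additive Gal(K/k) →+ AddCircle (1 : ℚ)) : Prop :=
  ∃ (c : Z1 Gal(SeparableClosure k/k) (CharGroup k K k))
    (b : Gal(SeparableClosure k/k) → Character (weilTorus k K) (SeparableClosure k))
    (ψ : Gal(SeparableClosure k/k) → ℚ)
    (z : Gal(SeparableClosure k/k) → Gal(SeparableClosure k/k) → ℤ),
    x = H1.mk c ∧ IsLocallyConstant b ∧ IsLocallyConstant ψ ∧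
    (∀ σ, (b σ).restrictNormOne = c.1 σ) ∧
    (∀ σ, (ψ σ : AddCircle (1 : ℚ)) = χ (Additive.ofMul (AlgEquiv.restrictNormalHom K σ))) ∧
    (∀ σ τ, b σ + σ • b τ - b (σ * τ) =
      z σ τ • Character.normCharacter k K (SeparableClosure k)) ∧
    (∀ σ τ, ψ σ + ψ τ - ψ (σ * τ) = (z σ τ : ℚ))

/-! ### The group `G(K₀, K')` -/

section GroupG

variable {k : Type u} [Field k] (p : ℕ) (K₀ : IntermediateField k (SeparableClosure k))
  {ι : Type*} (K' : ι → IntermediateField k (SeparableClosure k))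

/-- `M_i = K₀ K_i`, as an extension of `K_i`. -/
abbrev compositum (K₀ K₁ : IntermediateField k (SeparableClosure k)) :
    IntermediateField K₁ (SeparableClosure k) :=
  IntermediateField.extendScalars (le_sup_right : K₁ ≤ K₀ ⊔ K₁)

/-- The exponent `e_i` with `p ^ e_i = [M_i : K_i]`. -/
def globalExp (i : ι) : ℕ := padicValNat p (Module.finrank (K' i) (compositum K₀ (K' i)))

/-- The exponent `r` with `p ^ r = [L_w : F_v]` for the places `w ∣ v` of `L`, for a Galois
extension `L/F` of `p`-power degree (all `w ∣ v` have the same local degree, a power of `p`). -/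
def localExp {F : Type u} [Field F] (v : AbsoluteValue F ℝ) (L : Type u) [Field L]
    [Algebra F L] : ℕ :=
  ⨆ w : PlaceOver v L, padicValNat p (Module.finrank v.Completion w.abs.Completion)

/-- `e(v)`, with `p ^ e(v) = [K_{0,ṽ} : k_v]` for `ṽ ∣ v`. -/
def expAt (v : Place k) : ℕ := localExp p v.abs K₀

/-- `e_i(w)`, with `p ^ e_i(w) = [M_{i,w̃} : K_{i,w}]` for `w̃ ∣ w`. -/
def expOver {v : Place k} (i : ι) (w : PlaceOver v.abs (K' i)) : ℕ :=
  localExp p w.abs (compositum K₀ (K' i))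

/-- `e_i(v)`, the maximum of `e_i(w)` over the places `w ∣ v` of `K_i`. -/
def expMaxAt (v : Place k) (i : ι) : ℕ := ⨆ w : PlaceOver v.abs (K' i), expOver p K₀ K' i w

variable {p} in
/-- The projection `π_{s,t} : ℤ/p^s → ℤ/p^t`, for `t ≤ s`. -/
def proj {s : ℕ} (t : ℕ) (a : ZMod (p ^ s)) : ZMod (p ^ t) := a.cast

/-- The group `⊕ᵢ ℤ/p^{e_i}`. -/
abbrev SumZMod : Type _ := ∀ i : ι, ZMod (p ^ globalExp p K₀ K' i)

/-- The largest of the `e_i`, that is `e_1` if `e_1 ≥ e_2 ≥ … ≥ e_m`. -/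
def maxExp [Fintype ι] : ℕ := Finset.univ.sup (globalExp p K₀ K')

variable {p K₀ K'}

/-- `δ(n, a_i)`, the largest `r` with `n ≡ a_i mod p^r` (which makes sense for `r ≤ e_i`). -/
def delta [Fintype ι] (n : ZMod (p ^ maxExp p K₀ K')) (a : SumZMod p K₀ K') (i : ι) : ℕ :=
  sSup {r | r ≤ globalExp p K₀ K' i ∧ proj r n = proj r (a i)}

/-- `I_n(a)`, the set of `i` with `π(n) = a_i` in `ℤ/p^{e_i}`. -/
def indexSet [Fintype ι] (n : ZMod (p ^ maxExp p K₀ K')) (a : SumZMod p K₀ K') : Set ι :=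
  {i | proj (globalExp p K₀ K' i) n = a i}

/-- `Ω(I_n(a))`, the set of places `v` such that `e_i(w) ≤ δ(n, a_i)` for all `i ∉ I_n(a)` and
all places `w ∣ v` of `K_i`. -/
def omegaSet [Fintype ι] (n : ZMod (p ^ maxExp p K₀ K')) (a : SumZMod p K₀ K') :
    Set (Place k) :=
  {v | ∀ i ∉ indexSet n a, ∀ w : PlaceOver v.abs (K' i), expOver p K₀ K' i w ≤ delta n a i}

variable (p K₀ K') in
/-- `G(K₀, K')`, the set of `a ∈ ⊕ᵢ ℤ/p^{e_i}` such that the sets `Ω(I_n(a))` cover `Ω_k`. -/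
def groupG [Fintype ι] : Set (SumZMod p K₀ K') :=
  {a | ⋃ n : ZMod (p ^ maxExp p K₀ K'), omegaSet n a = Set.univ}

/-- `a` is locally diagonal at `v`: some `n ∈ ℤ/p^{e(v)}` satisfies `n ≡ a_i mod p^{e_i(v)}` for
all `i`. -/
def LocallyDiagonalAt (a : SumZMod p K₀ K') (v : Place k) : Prop :=
  ∃ n : ZMod (p ^ expAt p K₀ v), ∀ i,
    proj (expMaxAt p K₀ K' v i) n = proj (expMaxAt p K₀ K' v i) (a i)

end GroupG

end

end Multinorm

open Multinorm

/-! For an extension `F/k`, let `D_F` be the image of `Γ_F` in `Gal(K₀/k)`. Over `F_s` the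
characters of `R_{K₀/k} 𝔾_m` form the permutation lattice on the embeddings of `K₀`, and `T̂` is its
quotient by the norm. The lattice has no `H¹`, so `H¹(F, T̂)` embeds into `H²(F, ℤ) = H¹(F, ℚ/ℤ)`,
with image the characters of `Γ_F` trivial on the elements that fix every embedding, that is, the
characters of `D_F`. As `ℚ/ℤ` is injective, each of these extends to `Gal(K₀/k)`. This yields a
surjection `theta` from `Hom(Gal(K₀/k), ℚ/ℤ)` onto every `H¹(F, T̂)`, whose kernel is the group of
characters trivial on `D_F` (`theta_surjective`, `theta_eq_zero_iff`) and which commutes with base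
change (`baseChange_theta`).

Since `Gal(K₀/k)` is cyclic of order `p^e`, a character `γ⁻¹(n)` is trivial on the subgroup of order
`p^h` exactly when `n ≡ 0 mod p^h` (`theta_symm_eq_zero_iff`). Thus `H¹(F, T̂)` is `ℤ/p^h` with `p^h
= |D_F|`, and base change is reduction. For `F = K_i` one has `h = e_i`, and for `F = K_{i,w}` one
has `h = e_i(w)`, because `|D_F|` is the degree of any extension of `F` generated by a copy of `K₀`
(`finrank_eq_card_range_galHom`).

Membership in `S` therefore says: for each `v` some `n` satisfies `n ≡ a_i mod p^{e_i(w)}` for all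
`i` and all `w ∣ v` (`theta_mem_selmerGroup_iff`). The conditions defining `G` and local diagonality
unwind to the same congruences (`mem_groupG_iff`, `locallyDiagonalAt_iff`). Absolute values are
extended to algebraic extensions so that the suprema over places defining the local exponents are
never empty. -/

/-! ### Units of group algebras -/

/-- A unit of the group algebra over a domain of a group with two unique products is a
multiple of a group element. -/
theorem MonoidAlgebra.exists_single_of_isUnit {A M : Type*} [Semiring A] [NoZeroDivisors A]
    [Nontrivial A] [Group M] [TwoUniqueProds M] {a : MonoidAlgebra A M} (ha : IsUnit a) :
    ∃ m c, a = MonoidAlgebra.single m c := by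
  obtain ⟨u, rfl⟩ := ha
  set a : MonoidAlgebra A M := u.val
  set b : MonoidAlgebra A M := u⁻¹.val
  have hab : a * b = 1 := u.mul_inv
  have hne : ∀ {p q : M}, UniqueMul a.coeff.support b.coeff.support p q →
      p ∈ a.coeff.support → q ∈ b.coeff.support → p * q = 1 := by
    intro p q h hp hq
    have h1 := MonoidAlgebra.coeff_mul_mul_of_uniqueMul h
    rw [hab] at h1
    by_contra hpq
    have h2 : a.coeff p * b.coeff q ≠ 0 :=
      mul_ne_zero (Finsupp.mem_support_iff.1 hp) (Finsupp.mem_support_iff.1 hq)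
    rw [← h1, MonoidAlgebra.one_def] at h2
    apply h2
    simp [MonoidAlgebra.coeff_single, Ne.symm hpq]
  -- Two distinct pairs with uniquely represented products would give two nonzero coefficients of `a
  -- * b = 1`. Both products would then equal `1`, and uniqueness would identify the pairs.
  have hcard : ¬ 1 < a.coeff.support.card * b.coeff.support.card := by
    intro h
    obtain ⟨p, hp, q, hq, hpq, h1, h2⟩ := TwoUniqueProds.uniqueMul_of_one_lt_card h
    rw [Finset.mem_product] at hp hq
    have e1 := hne h1 hp.1 hp.2
    have e2 := hne h2 hq.1 hq.2
    have := h1 hq.1 hq.2 (e2.trans e1.symm)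
    exact hpq (Prod.ext this.1.symm this.2.symm)
  have ha0 : a ≠ 0 := u.ne_zero
  have hb0 : b ≠ 0 := (u⁻¹).ne_zero
  have hac : 0 < a.coeff.support.card := by
    rw [Finset.card_pos, Finsupp.support_nonempty_iff]
    exact fun h => ha0 (MonoidAlgebra.ext h)
  have hbc : 0 < b.coeff.support.card := by
    rw [Finset.card_pos, Finsupp.support_nonempty_iff]
    exact fun h => hb0 (MonoidAlgebra.ext h)
  have h1 : a.coeff.support.card ≤ 1 := by nlinarith
  obtain ⟨m, c, hm⟩ := Finsupp.card_support_le_one'.1 h1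
  exact ⟨m, c, MonoidAlgebra.ext hm⟩

namespace Multinorm

noncomputable section

/-! ### Characters of `R_{K/k} 𝔾_m` and of the norm-one torus over a splitting field -/

section Characters

variable {k K Ω : Type u} [Field k] [Field K] [Algebra k K] [Field Ω] [Algebra k Ω]

/-- The projection `R ⊗ K → R` attached to an embedding `x : K → Ω`, for an `Ω`-algebra `R`. -/
def tensorEval {R : Type u} [CommRing R] [Algebra k R] (φ : Ω →ₐ[k] R) (x : K →ₐ[k] Ω) :
    R ⊗[k] K →ₐ[R] R :=
  Algebra.TensorProduct.lift (AlgHom.id R R) (φ.comp x) fun _ _ => .all _ _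

@[simp]
theorem tensorEval_tmul {R : Type u} [CommRing R] [Algebra k R] (φ : Ω →ₐ[k] R) (x : K →ₐ[k] Ω)
    (r : R) (a : K) : tensorEval φ x (r ⊗ₜ a) = r * φ (x a) := by
  simp [tensorEval]

theorem tensorEval_map {R R' : Type u} [CommRing R] [Algebra k R] [CommRing R'] [Algebra k R']
    (φ : Ω →ₐ[k] R) (f : R →ₐ[k] R') (x : K →ₐ[k] Ω) (u : R ⊗[k] K) :
    tensorEval (f.comp φ) x (Algebra.TensorProduct.map f (AlgHom.id k K) u) =
      f (tensorEval φ x u) := by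
  induction u with
  | zero => simp
  | add a b ha hb => simp only [map_add, ha, hb]
  | tmul r a => simp

/-- The homomorphism `(R ⊗ K)ˣ → Rˣ` attached to an embedding `x : K → Ω`. -/
def unitsEval {R : Type u} [CommRing R] [Algebra k R] (φ : Ω →ₐ[k] R) (x : K →ₐ[k] Ω) :
    (R ⊗[k] K)ˣ →* Rˣ := Units.map (tensorEval φ x : R ⊗[k] K →* R)

theorem unitsEval_unitsMap {R R' : Type u} [CommRing R] [Algebra k R] [CommRing R']
    [Algebra k R'] (φ : Ω →ₐ[k] R) (f : R →ₐ[k] R') (x : K →ₐ[k] Ω) (u : (R ⊗[k] K)ˣ) :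
    unitsEval (f.comp φ) x (unitsMap k K f u) = Units.map f.toMonoidHom (unitsEval φ x u) := by
  ext
  exact tensorEval_map φ f x u

theorem unitsEval_comp {Ω' R : Type u} [Field Ω'] [Algebra k Ω'] [CommRing R] [Algebra k R]
    (φ : Ω' →ₐ[k] R) (j : Ω →ₐ[k] Ω') (x : K →ₐ[k] Ω) :
    unitsEval (φ.comp j) x = unitsEval φ (j.comp x) := rfl

/-- The group algebra of the character lattice, the coordinate ring of the split torus. -/
abbrev LaurentRing (k K Ω : Type u) [Field k] [Field K] [Algebra k K] [Field Ω] [Algebra k Ω] :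
    Type u := MonoidAlgebra Ω ((K →ₐ[k] Ω) → Multiplicative ℤ)

/-- The structure map of `LaurentRing`. -/
def laurentAlg : Ω →ₐ[k] LaurentRing k K Ω := IsScalarTower.toAlgHom k Ω _

/-- The monomials of `LaurentRing`. -/
def laurentMon : ((K →ₐ[k] Ω) → Multiplicative ℤ) →* (LaurentRing k K Ω)ˣ :=
  (MonoidAlgebra.of Ω ((K →ₐ[k] Ω) → Multiplicative ℤ)).toHomUnits

theorem laurentMon_injective : Function.Injective (laurentMon (k := k) (K := K) (Ω := Ω)) :=
  fun _ _ h => MonoidAlgebra.of_injective (congrArg Units.val h)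

/-- The action of `Gal(Ω/F)` on the embeddings of `K` into `Ω`. -/
def galComp {F : Type u} [Field F] [Algebra k F] [Algebra F Ω] [IsScalarTower k F Ω]
    (σ : Gal(Ω/F)) (x : K →ₐ[k] Ω) : K →ₐ[k] Ω :=
  ((σ : Ω →ₐ[F] Ω).restrictScalars k).comp x

section

variable {F : Type u} [Field F] [Algebra k F] [Algebra F Ω] [IsScalarTower k F Ω]

theorem galComp_apply (σ : Gal(Ω/F)) (x : K →ₐ[k] Ω) (a : K) : galComp σ x a = σ (x a) := rfl

theorem galComp_inv_galComp (σ : Gal(Ω/F)) (x : K →ₐ[k] Ω) : galComp σ⁻¹ (galComp σ x) = x :=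
  AlgHom.ext fun _ => σ.symm_apply_apply _

theorem galComp_galComp_inv (σ : Gal(Ω/F)) (x : K →ₐ[k] Ω) : galComp σ (galComp σ⁻¹ x) = x :=
  AlgHom.ext fun _ => σ.apply_symm_apply _

theorem galComp_bijective (σ : Gal(Ω/F)) :
    Function.Bijective (galComp σ : (K →ₐ[k] Ω) → (K →ₐ[k] Ω)) :=
  Function.bijective_iff_has_inverse.2 ⟨galComp σ⁻¹, galComp_inv_galComp σ, galComp_galComp_inv σ⟩

end

variable [Module.Finite k K]

/-- The character `∏ x, x ^ f x` of `R_{K/k} 𝔾_m`. -/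
def weilChar (f : (K →ₐ[k] Ω) → ℤ) : Character (weilTorus k K) Ω where
  app _ _ _ φ := (∏ x, unitsEval φ x ^ f x).comp (Subgroup.subtype _)
  natural φ g u := by
    simp [MonoidHom.finsetProd_apply, unitsEval_unitsMap]

theorem weilChar_app (f : (K →ₐ[k] Ω) → ℤ) (R : Type u) [CommRing R] [Algebra k R]
    (φ : Ω →ₐ[k] R) (u : (weilTorus k K).points R) :
    (weilChar f).app R φ u = ∏ x, unitsEval φ x u ^ f x := by
  simp [weilChar, MonoidHom.finsetProd_apply]

theorem weilChar_add (f g : (K →ₐ[k] Ω) → ℤ) : weilChar (f + g) = weilChar f + weilChar g := by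
  ext R _ _ φ u
  simp [Character.add_app, weilChar_app, zpow_add, Finset.prod_mul_distrib]

theorem smul_weilChar {F : Type u} [Field F] [Algebra k F] [Algebra F Ω] [IsScalarTower k F Ω]
    (σ : Gal(Ω/F)) (f : (K →ₐ[k] Ω) → ℤ) :
    σ • weilChar f = weilChar fun x => f (galComp σ⁻¹ x) := by
  apply Character.ext
  funext R _ _ φ
  ext1 u
  change (weilChar f).app R _ u = _
  rw [weilChar_app, weilChar_app]
  simp_rw [unitsEval_comp]
  refine Fintype.prod_bijective (galComp σ) (galComp_bijective σ) _ _ fun x => ?_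
  rw [galComp_inv_galComp]
  rfl

variable (hX : Nat.card (K →ₐ[k] Ω) = Module.finrank k K)

/-- Over a splitting field, the projections identify `R ⊗ K` with a power of `R`. -/
theorem tensorEval_bijective
    (hX : Nat.card (K →ₐ[k] Ω) = Module.finrank k K) {R : Type u} [CommRing R]
    [Algebra k R] (φ : Ω →ₐ[k] R) :
    Function.Bijective fun (u : R ⊗[k] K) (x : K →ₐ[k] Ω) => tensorEval φ x u := by
  classical
  let b : Module.Basis (K →ₐ[k] Ω) k K := (Module.finBasis k K).reindex
    (Fintype.equivOfCardEq (by simpa using hX.symm))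
  let M : Matrix (K →ₐ[k] Ω) (K →ₐ[k] Ω) Ω := .of fun x y => x (b y)
  -- Dedekind's independence of the embeddings; `hX` is what makes the matrix square.
  have hM : IsUnit M := by
    rw [← Matrix.linearIndependent_rows_iff_isUnit, Fintype.linearIndependent_iff]
    intro g hg
    refine Fintype.linearIndependent_iff.1 (linearIndependent_algHom_toLinearMap k K Ω) g ?_
    refine b.ext fun y => ?_
    have := congrFun hg y
    simpa [M] using this
  have hM' : IsUnit (M.map φ) := hM.map (φ.toRingHom.mapMatrix)
  obtain ⟨N, hN⟩ := hM'
  let B := Algebra.TensorProduct.basis R b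
  have key : ∀ c : (K →ₐ[k] Ω) → R, (fun x => tensorEval φ x (B.equivFun.symm c)) =
      (M.map φ).mulVec c := by
    intro c
    funext x
    simp [B, Module.Basis.equivFun_symm_apply, Matrix.mulVec, dotProduct, M,
      Algebra.TensorProduct.basis_apply, mul_comm]
  have hbij : Function.Bijective ((M.map φ).mulVec) := by
    refine Function.bijective_iff_has_inverse.2
      ⟨(N⁻¹ : (Matrix (K →ₐ[k] Ω) (K →ₐ[k] Ω) R)ˣ).1.mulVec, fun v => ?_, fun v => ?_⟩
    · rw [← hN, Matrix.mulVec_mulVec, N.inv_mul, Matrix.one_mulVec]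
    · rw [← hN, Matrix.mulVec_mulVec, N.mul_inv, Matrix.one_mulVec]
  have : (fun (u : R ⊗[k] K) (x : K →ₐ[k] Ω) => tensorEval φ x u) =
      (M.map φ).mulVec ∘ B.equivFun := by
    funext u
    have := key (B.equivFun u)
    rwa [B.equivFun.symm_apply_apply] at this
  rw [this]
  exact hbij.comp B.equivFun.bijective

/-- `R ⊗ K ≃ ∏ R` over the embeddings of `K` into the splitting field. -/
def tensorEquiv {R : Type u} [CommRing R] [Algebra k R] (φ : Ω →ₐ[k] R) :
    R ⊗[k] K ≃ₐ[R] ((K →ₐ[k] Ω) → R) :=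
  AlgEquiv.ofBijective (AlgHom.pi fun x => tensorEval φ x) (tensorEval_bijective hX φ)

/-- In the coordinates of `tensorEquiv`, multiplication by `u` is a diagonal matrix. -/
theorem norm_eq_prod_tensorEval
    (hX : Nat.card (K →ₐ[k] Ω) = Module.finrank k K) {R : Type u} [CommRing R]
    [Algebra k R] (φ : Ω →ₐ[k] R)
    (u : R ⊗[k] K) : Algebra.norm R u = ∏ x, tensorEval φ x u := by
  classical
  rw [← Algebra.norm_eq_of_algEquiv (tensorEquiv hX φ),
    Algebra.norm_eq_matrix_det (Pi.basisFun R _)]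
  have : Algebra.leftMulMatrix (Pi.basisFun R _) (tensorEquiv hX φ u) =
      Matrix.diagonal (tensorEquiv hX φ u) := by
    ext i j
    simp [Algebra.leftMulMatrix_eq_repr_mul, Matrix.diagonal_apply, Pi.single_apply]
  rw [this, Matrix.det_diagonal]
  rfl

/-- The point of `R_{K/k} 𝔾_m` over an `Ω`-algebra with given coordinates. -/
def unitsPoint {R : Type u} [CommRing R] [Algebra k R] (φ : Ω →ₐ[k] R)
    (t : (K →ₐ[k] Ω) → Rˣ) : (R ⊗[k] K)ˣ :=
  Units.map ((tensorEquiv hX φ).symm : ((K →ₐ[k] Ω) → R) →* R ⊗[k] K)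
    (MulEquiv.piUnits.symm t)

@[simp]
theorem unitsEval_unitsPoint {R : Type u} [CommRing R] [Algebra k R] (φ : Ω →ₐ[k] R)
    (t : (K →ₐ[k] Ω) → Rˣ) (x : K →ₐ[k] Ω) : unitsEval φ x (unitsPoint hX φ t) = t x := by
  ext
  change tensorEquiv hX φ ((tensorEquiv hX φ).symm (MulEquiv.piUnits.symm t).1) x = _
  rw [AlgEquiv.apply_symm_apply]
  rfl

theorem units_ext_eval
    (hX : Nat.card (K →ₐ[k] Ω) = Module.finrank k K) {R : Type u} [CommRing R]
    [Algebra k R] (φ : Ω →ₐ[k] R)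
    {u v : (R ⊗[k] K)ˣ} (h : ∀ x, unitsEval φ x u = unitsEval φ x v) : u = v := by
  ext
  refine (tensorEval_bijective hX φ).1 (funext fun x => ?_)
  exact congrArg Units.val (h x)

theorem mem_normOne_iff
    (hX : Nat.card (K →ₐ[k] Ω) = Module.finrank k K) {R : Type u} [CommRing R]
    [Algebra k R] (φ : Ω →ₐ[k] R)
    (u : (R ⊗[k] K)ˣ) : u ∈ (normOneTorus k K).points R ↔ ∏ x, unitsEval φ x u = 1 := by
  change u ∈ (Units.map (Algebra.norm R : R ⊗[k] K →* R)).ker ↔ _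
  rw [MonoidHom.mem_ker, Units.ext_iff, Units.ext_iff]
  simp only [Units.coe_map, Units.val_one, Units.coe_prod]
  change Algebra.norm R (u : R ⊗[k] K) = 1 ↔ _
  rw [norm_eq_prod_tensorEval hX φ]
  rfl

theorem weilChar_one
    (hX : Nat.card (K →ₐ[k] Ω) = Module.finrank k K) :
    weilChar 1 = Character.normCharacter k K Ω := by
  apply Character.ext
  funext R _ _ φ
  ext u
  rw [weilChar_app]
  simp only [Pi.one_apply, zpow_one, Units.coe_prod]
  exact (norm_eq_prod_tensorEval hX φ _).symm

open Classical in
/-- The coordinates of `LaurentRing`. -/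
def laurentVar (x : K →ₐ[k] Ω) : (LaurentRing k K Ω)ˣ :=
  laurentMon (Pi.mulSingle x (Multiplicative.ofAdd 1))

/-- The homomorphism from `LaurentRing` with given values on the coordinates. -/
def laurentLift {R : Type u} [CommRing R] [Algebra k R] (φ : Ω →ₐ[k] R)
    (t : (K →ₐ[k] Ω) → Rˣ) : LaurentRing k K Ω →ₐ[k] R :=
  MonoidAlgebra.liftNCAlgHom φ
    ((Units.coeHom R).comp (∏ x, ((zpowersHom Rˣ (t x)).comp (Pi.evalMonoidHom _ x))))
    fun _ _ => .all _ _

theorem laurentLift_single {R : Type u} [CommRing R] [Algebra k R] (φ : Ω →ₐ[k] R)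
    (t : (K →ₐ[k] Ω) → Rˣ) (m : (K →ₐ[k] Ω) → Multiplicative ℤ) (c : Ω) :
    laurentLift φ t (MonoidAlgebra.single m c) =
      φ c * ((∏ x, t x ^ (m x).toAdd : Rˣ) : R) := by
  change MonoidAlgebra.liftNC _ _ _ = _
  rw [MonoidAlgebra.liftNC_single]
  simp [MonoidHom.finsetProd_apply, zpowersHom_apply]

theorem laurentLift_comp {R : Type u} [CommRing R] [Algebra k R] (φ : Ω →ₐ[k] R)
    (t : (K →ₐ[k] Ω) → Rˣ) : (laurentLift φ t).comp laurentAlg = φ := by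
  ext c
  change laurentLift φ t (MonoidAlgebra.single 1 c) = _
  rw [laurentLift_single]
  simp

theorem laurentLift_var {R : Type u} [CommRing R] [Algebra k R] (φ : Ω →ₐ[k] R)
    (t : (K →ₐ[k] Ω) → Rˣ) (x : K →ₐ[k] Ω) :
    Units.map (laurentLift φ t).toMonoidHom (laurentVar x) = t x := by
  classical
  ext
  change laurentLift φ t (MonoidAlgebra.single _ 1) = _
  rw [laurentLift_single, Finset.prod_eq_single x]
  · simp
  · intro y _ hy; simp [Pi.mulSingle_eq_of_ne hy]
  · simp

/-- A character of a subtorus of `R_{K/k} 𝔾_m` with a versal point over the Laurent ring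
is a product of powers of the projections. -/
theorem exists_app_eq_prod {T : GroupFunctor k K} (χ : Character T Ω)
    (P : (LaurentRing k K Ω ⊗[k] K)ˣ) (hP : P ∈ T.points (LaurentRing k K Ω))
    (hv : ∀ (R : Type u) [CommRing R] [Algebra k R] (φ : Ω →ₐ[k] R) (u : T.points R),
      unitsMap k K (laurentLift φ fun x => unitsEval φ x u) P = u) :
    ∃ f : (K →ₐ[k] Ω) → ℤ, ∀ (R : Type u) [CommRing R] [Algebra k R] (φ : Ω →ₐ[k] R)
      (u : T.points R), χ.app R φ u = ∏ x, unitsEval φ x u ^ f x := by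
  -- The value at the versal point is a unit of a Laurent ring, hence a monomial times a scalar; by
  -- naturality this one value determines the character.
  obtain ⟨m, c, hmc⟩ := MonoidAlgebra.exists_single_of_isUnit
    (χ.app (LaurentRing k K Ω) laurentAlg ⟨P, hP⟩).isUnit
  have key : ∀ (R : Type u) [CommRing R] [Algebra k R] (φ : Ω →ₐ[k] R) (u : T.points R),
      (χ.app R φ u : R) = φ c * ((∏ x, unitsEval φ x u ^ (m x).toAdd : Rˣ) : R) := by
    intro R _ _ φ u
    have h := χ.natural laurentAlg (laurentLift φ fun x => unitsEval φ x u) ⟨P, hP⟩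
    have hu : (⟨unitsMap k K (laurentLift φ fun x => unitsEval φ x u) P,
        T.map_mem _ P hP⟩ : T.points R) = u := Subtype.ext (hv R φ u)
    rw [laurentLift_comp, hu] at h
    rw [h]
    change laurentLift φ _ (χ.app (LaurentRing k K Ω) laurentAlg ⟨P, hP⟩ : LaurentRing k K Ω) = _
    rw [hmc, laurentLift_single]
  -- The neutral point of `T(Ω)` must go to `1`.
  have hc : c = 1 := by
    have := key Ω (AlgHom.id k Ω) 1
    simpa using this.symm
  refine ⟨fun x => (m x).toAdd, fun R _ _ φ u => ?_⟩
  ext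
  rw [key, hc, map_one, one_mul]

theorem weilChar_surjective
    (hX : Nat.card (K →ₐ[k] Ω) = Module.finrank k K) :
    Function.Surjective (weilChar (k := k) (K := K) (Ω := Ω)) := by
  intro χ
  obtain ⟨f, hf⟩ := exists_app_eq_prod χ (unitsPoint hX laurentAlg laurentVar) trivial
    fun R _ _ φ u => by
      refine units_ext_eval hX φ fun x => ?_
      have := unitsEval_unitsMap laurentAlg (laurentLift φ fun x => unitsEval φ x u) x
        (unitsPoint hX laurentAlg laurentVar)
      rw [laurentLift_comp] at this
      rw [this, unitsEval_unitsPoint, laurentLift_var]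
  refine ⟨f, ?_⟩
  apply Character.ext
  funext R _ _ φ
  ext1 u
  rw [hf, weilChar_app]

theorem weilChar_injective
    (hX : Nat.card (K →ₐ[k] Ω) = Module.finrank k K) :
    Function.Injective (weilChar (k := k) (K := K) (Ω := Ω)) := by
  classical
  intro f g h
  funext y
  -- At the point whose only nontrivial coordinate is the variable at `y`, the character takes the
  -- value of that variable to the power `f y`.
  have h1 := congrArg (fun χ : Character (weilTorus k K) Ω => χ.app (LaurentRing k K Ω) laurentAlg
    ⟨unitsPoint hX laurentAlg (Pi.mulSingle y (laurentVar y)), trivial⟩) h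
  simp only [weilChar_app, unitsEval_unitsPoint] at h1
  rw [Finset.prod_eq_single y (fun x _ hx => by simp [Pi.mulSingle_eq_of_ne hx]) (by simp),
    Finset.prod_eq_single y (fun x _ hx => by simp [Pi.mulSingle_eq_of_ne hx]) (by simp)] at h1
  simp only [Pi.mulSingle_eq_same, laurentVar, ← map_zpow] at h1
  have := congrFun (laurentMon_injective h1) y
  simpa [← ofAdd_zsmul] using this

/-- Characters of `R_{K/k} 𝔾_m` over a splitting field. -/
def weilCharEquiv : ((K →ₐ[k] Ω) → ℤ) ≃+ Character (weilTorus k K) Ω :=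
  { Equiv.ofBijective weilChar ⟨weilChar_injective hX, weilChar_surjective hX⟩ with
    map_add' := weilChar_add }

theorem weilCharEquiv_apply (f : (K →ₐ[k] Ω) → ℤ) : weilCharEquiv hX f = weilChar f := rfl

/-- Restriction of characters to the norm-one torus, as a homomorphism. -/
def restrictHom : Character (weilTorus k K) Ω →+ Character (normOneTorus k K) Ω where
  toFun := Character.restrictNormOne
  map_zero' := rfl
  map_add' _ _ := rfl

theorem restrictNormOne_smul {F : Type u} [Field F] [Algebra k F] [Algebra F Ω]
    [IsScalarTower k F Ω] (σ : Gal(Ω/F)) (χ : Character (weilTorus k K) Ω) :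
    restrictHom (σ • χ) = σ • restrictHom χ := rfl

theorem restrictHom_normCharacter : restrictHom (Character.normCharacter k K Ω) = 0 := by
  apply Character.ext
  funext R _ _ φ
  ext1 u
  exact u.2

theorem restrictHom_surjective
    (hX : Nat.card (K →ₐ[k] Ω) = Module.finrank k K) [Nonempty (K →ₐ[k] Ω)] :
    Function.Surjective (restrictHom (k := k) (K := K) (Ω := Ω)) := by
  classical
  intro χ
  obtain ⟨x₀⟩ := ‹Nonempty (K →ₐ[k] Ω)›
  -- The generic point of the norm-one torus: the coordinate at `x₀` is forced to be the inverse of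
  -- the product of the others. It stays versal because a norm-one point obeys the same relation.
  let t : (K →ₐ[k] Ω) → (LaurentRing k K Ω)ˣ :=
    Function.update laurentVar x₀ (∏ x ∈ Finset.univ.erase x₀, laurentVar x)⁻¹
  have ht : ∏ x, t x = 1 := by
    rw [← Finset.mul_prod_erase _ _ (Finset.mem_univ x₀),
      Finset.prod_congr rfl fun x hx => Function.update_of_ne (Finset.ne_of_mem_erase hx) _ _]
    simp [t]
  obtain ⟨f, hf⟩ := exists_app_eq_prod χ (unitsPoint hX laurentAlg t)
    ((mem_normOne_iff hX laurentAlg _).2 (by simpa using ht)) fun R _ _ φ u => by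
      refine units_ext_eval hX φ fun x => ?_
      have := unitsEval_unitsMap laurentAlg (laurentLift φ fun x => unitsEval φ x u) x
        (unitsPoint hX laurentAlg t)
      rw [laurentLift_comp] at this
      rw [this, unitsEval_unitsPoint]
      by_cases hx : x = x₀
      · subst hx
        simp only [t, Function.update_self, map_inv, map_prod, laurentLift_var]
        rw [inv_eq_iff_mul_eq_one, mul_comm]
        exact (Finset.mul_prod_erase Finset.univ (fun x => unitsEval φ x u.1)
          (Finset.mem_univ x)).trans ((mem_normOne_iff hX φ u).1 u.2)
      · simp only [t, Function.update_of_ne hx, laurentLift_var]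
  refine ⟨weilChar f, ?_⟩
  apply Character.ext
  funext R _ _ φ
  ext1 u
  rw [hf]
  exact weilChar_app f R φ _

theorem exists_zsmul_of_restrictHom_eq_zero
    (hX : Nat.card (K →ₐ[k] Ω) = Module.finrank k K) {χ : Character (weilTorus k K) Ω}
    (h : restrictHom χ = 0) : ∃ n : ℤ, χ = n • Character.normCharacter k K Ω := by
  classical
  obtain ⟨f, rfl⟩ := weilChar_surjective hX χ
  have hconst : ∀ x y, f x = f y := by
    intro x y
    by_cases hxy : x = y
    · rw [hxy]
    -- A norm-one point with coordinate a variable at `x` and its inverse at `y`: triviality there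
    -- forces `f x = f y`.
    let t : (K →ₐ[k] Ω) → (LaurentRing k K Ω)ˣ :=
      Pi.mulSingle x (laurentVar x) * Pi.mulSingle y (laurentVar x)⁻¹
    have hp : ∀ g : (K →ₐ[k] Ω) → ℤ, ∏ z, t z ^ g z = laurentVar x ^ (g x - g y) := by
      intro g
      simp only [t, Pi.mul_apply, mul_zpow, Finset.prod_mul_distrib]
      rw [Finset.prod_eq_single x (fun z _ hz => by simp [Pi.mulSingle_eq_of_ne hz]) (by simp),
        Finset.prod_eq_single y (fun z _ hz => by simp [Pi.mulSingle_eq_of_ne hz]) (by simp)]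
      simp [zpow_sub]
    have ht : unitsPoint hX laurentAlg t ∈ (normOneTorus k K).points (LaurentRing k K Ω) := by
      rw [mem_normOne_iff hX laurentAlg]
      simpa using hp 1
    have h1 := congrArg (fun χ : Character (normOneTorus k K) Ω =>
      χ.app (LaurentRing k K Ω) laurentAlg ⟨unitsPoint hX laurentAlg t, ht⟩) h
    have h2 : (weilChar f).app (LaurentRing k K Ω) laurentAlg
        ⟨unitsPoint hX laurentAlg t, trivial⟩ = 1 := h1
    simp only [weilChar_app, unitsEval_unitsPoint] at h2
    rw [hp, laurentVar, ← map_zpow, ← map_one laurentMon] at h2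
    have := congrFun (laurentMon_injective h2) x
    simp only [Pi.pow_apply, Pi.mulSingle_eq_same, Pi.one_apply, ← ofAdd_zsmul] at this
    have := congrArg Multiplicative.toAdd this
    simp at this
    omega
  rcases isEmpty_or_nonempty (K →ₐ[k] Ω) with h0 | ⟨⟨x⟩⟩
  · exact ⟨0, by rw [Subsingleton.elim f 0, zero_smul]; exact map_zero (weilCharEquiv hX)⟩
  · refine ⟨f x, ?_⟩
    rw [← weilChar_one hX]
    refine Eq.trans ?_ (map_zsmul (weilCharEquiv hX) (f x) 1)
    rw [weilCharEquiv_apply]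
    congr 1
    funext y
    simp [hconst y x]

end Characters

/-! ### Cocycles with finite range -/

/-- The sum of the values of a cocycle with finite range makes a multiple of it a coboundary. -/
theorem exists_nsmul_eq_sub_smul {Γ V : Type*} [Group Γ] [AddCommGroup V] [DistribMulAction Γ V]
    {c : Γ → V} (hc : ∀ σ τ, c (σ * τ) = c σ + σ • c τ) (hfin : (Set.range c).Finite) :
    ∃ (n : ℕ) (q : V), n ≠ 0 ∧ ∀ σ, n • c σ = q - σ • q := by
  classical
  let O : Finset V := hfin.toFinset
  have hO : ∀ v, v ∈ O ↔ ∃ σ, c σ = v := fun v => by simp [O]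
  refine ⟨O.card, ∑ o ∈ O, o, Finset.card_ne_zero.2 ⟨c 1, (hO _).2 ⟨1, rfl⟩⟩, fun σ => ?_⟩
  have hinj : Function.Injective fun o : V => σ • o + c σ := fun a b h =>
    MulAction.injective σ (add_right_cancel h)
  -- The cocycle relation says that the affine action `o ↦ σ • o + c σ` permutes the range of `c`,
  -- so it fixes the sum of the range up to the translation part.
  have himg : O.image (fun o => σ • o + c σ) = O := by
    refine Finset.eq_of_subset_of_card_le (fun v hv => ?_)
      (Finset.card_image_of_injective _ hinj).ge
    obtain ⟨o, ho, rfl⟩ := Finset.mem_image.1 hv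
    obtain ⟨τ, rfl⟩ := (hO o).1 ho
    exact (hO _).2 ⟨σ * τ, by rw [hc, add_comm]⟩
  have hsum : ∑ o ∈ O, o = ∑ o ∈ O, (σ • o + c σ) := by
    conv_lhs => rw [← himg]
    exact Finset.sum_image hinj.injOn
  rw [Finset.sum_add_distrib, Finset.sum_const, ← Finset.smul_sum] at hsum
  exact eq_sub_of_add_eq' hsum.symm

/-- The values `n * f σ` on powers of `σ` would be infinitely many. This is the vanishing of
continuous homomorphisms from a profinite group to `ℚ`. -/
theorem eq_zero_of_finite_range {Γ : Type*} [Group Γ] {f : Γ → ℚ}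
    (hf : ∀ σ τ, f (σ * τ) = f σ + f τ) (hfin : (Set.range f).Finite) (σ : Γ) : f σ = 0 := by
  by_contra h
  have h1 : f 1 = 0 := by simpa using hf 1 1
  have hn : ∀ n : ℕ, f (σ ^ n) = n * f σ := by
    intro n
    induction n with
    | zero => simp [h1]
    | succ n ih => rw [pow_succ, hf, ih]; push_cast; ring
  have hinj : Function.Injective fun n : ℕ => f (σ ^ n) := fun a b hab => by
    simp only [hn] at hab
    exact_mod_cast mul_right_cancel₀ h hab
  exact Set.infinite_range_of_injective hinj
    (hfin.subset (Set.range_subset_iff.2 fun n => ⟨_, rfl⟩))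

/-! ### The connecting map `H¹(F, T̂) → H¹(F, ℚ/ℤ)` -/

section Connecting

variable {k K F : Type u} [Field k] [Field K] [Algebra k K] [Module.Finite k K]
  [Field F] [Algebra k F]

variable (k K F) in
/-- The norm as a character over `F_s`. -/
abbrev normChar : Character (weilTorus k K) (SeparableClosure F) :=
  Character.normCharacter k K (SeparableClosure F)

/-- The class `x ∈ H¹(F, T̂_{K/k})` and the function `χ : Γ_F → ℚ/ℤ` have the same image in
`H²(F, ℤ)` under the connecting maps. -/
def Corr (x : GalH1 k K F) (χ : Gal(SeparableClosure F/F) → AddCircle (1 : ℚ)) : Prop :=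
  ∃ (c : Z1 Gal(SeparableClosure F/F) (CharGroup k K F))
    (b : Gal(SeparableClosure F/F) → Character (weilTorus k K) (SeparableClosure F))
    (ψ : Gal(SeparableClosure F/F) → ℚ)
    (z : Gal(SeparableClosure F/F) → Gal(SeparableClosure F/F) → ℤ),
    x = H1.mk c ∧ IsLocallyConstant b ∧ IsLocallyConstant ψ ∧
    (∀ σ, restrictHom (b σ) = c.1 σ) ∧
    (∀ σ, (ψ σ : AddCircle (1 : ℚ)) = χ σ) ∧
    (∀ σ τ, b σ + σ • b τ - b (σ * τ) = z σ τ • normChar k K F) ∧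
    (∀ σ τ, ψ σ + ψ τ - ψ (σ * τ) = (z σ τ : ℚ))

theorem Corr.sub {x y : GalH1 k K F} {χ χ' : Gal(SeparableClosure F/F) → AddCircle (1 : ℚ)}
    (h : Corr x χ) (h' : Corr y χ') : Corr (x - y) (χ - χ') := by
  obtain ⟨c, b, ψ, z, hx, hb, hψ, h1, h2, h3, h4⟩ := h
  obtain ⟨c', b', ψ', z', hx', hb', hψ', h1', h2', h3', h4'⟩ := h'
  refine ⟨c - c', b - b', ψ - ψ', z - z', ?_, hb.sub hb', hψ.sub hψ', fun σ => ?_, fun σ => ?_,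
    fun σ τ => ?_, fun σ τ => ?_⟩
  · rw [hx, hx']; exact (map_sub H1.mk c c').symm
  · rw [Pi.sub_apply, map_sub, h1, h1']; rfl
  · rw [Pi.sub_apply, Pi.sub_apply, ← h2, ← h2']; rfl
  · simp only [Pi.sub_apply, sub_smul, ← h3, ← h3', smul_sub]; abel
  · simp only [Pi.sub_apply, Int.cast_sub, ← h4, ← h4']; ring

theorem Corr.add {x y : GalH1 k K F} {χ χ' : Gal(SeparableClosure F/F) → AddCircle (1 : ℚ)}
    (h : Corr x χ) (h' : Corr y χ') : Corr (x + y) (χ + χ') := by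
  obtain ⟨c, b, ψ, z, hx, hb, hψ, h1, h2, h3, h4⟩ := h
  obtain ⟨c', b', ψ', z', hx', hb', hψ', h1', h2', h3', h4'⟩ := h'
  refine ⟨c + c', b + b', ψ + ψ', z + z', ?_, hb.add hb', hψ.add hψ', fun σ => ?_, fun σ => ?_,
    fun σ τ => ?_, fun σ τ => ?_⟩
  · rw [hx, hx']; exact (map_add H1.mk c c').symm
  · rw [Pi.add_apply, map_add, h1, h1']; rfl
  · rw [Pi.add_apply, Pi.add_apply, ← h2, ← h2']; rfl
  · simp only [Pi.add_apply, add_smul, ← h3, ← h3', smul_add]; abel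
  · simp only [Pi.add_apply, Int.cast_add, ← h4, ← h4']; ring

theorem Corr.baseChange {F' : Type u} [Field F'] [Algebra k F'] [Algebra F F']
    [IsScalarTower k F F'] {x : GalH1 k K F}
    {χ : Gal(SeparableClosure F/F) → AddCircle (1 : ℚ)} (h : Corr x χ) :
    Corr (baseChange K F F' x) (χ ∘ galRestrict IsSepClosed.lift) := by
  obtain ⟨c, b, ψ, z, hx, hb, hψ, h1, h2, h3, h4⟩ := h
  have := isScalarTower_sepClosure k F F'
  let j : SeparableClosure F →ₐ[F] SeparableClosure F' := IsSepClosed.lift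
  refine ⟨baseChangeZ1 K j c,
    fun σ => Character.map (j.restrictScalars k) (b (galRestrict j σ)),
    ψ ∘ galRestrict j, fun σ τ => z (galRestrict j σ) (galRestrict j τ), ?_,
    (hb.comp_continuous (galRestrict_continuous j)).comp _,
    hψ.comp_continuous (galRestrict_continuous j), fun σ => ?_, fun σ => h2 _,
    fun σ τ => ?_, fun σ τ => ?_⟩
  · rw [hx]; rfl
  · exact congrArg (Character.map (j.restrictScalars k)) (h1 (galRestrict j σ))
  · have h := congrArg (Character.map (j.restrictScalars k))
      (h3 (galRestrict j σ) (galRestrict j τ))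
    rw [map_sub, map_add, map_zsmul, map_galRestrict_smul, ← map_mul] at h
    exact h
  · have h := h4 (galRestrict j σ) (galRestrict j τ)
    rw [← map_mul] at h
    exact h

theorem normChar_eq (hX : Nat.card (K →ₐ[k] SeparableClosure F) = Module.finrank k K) :
    normChar k K F = weilChar 1 := (weilChar_one hX).symm

theorem normChar_zsmul_injective
    (hX : Nat.card (K →ₐ[k] SeparableClosure F) = Module.finrank k K) {m n : ℤ}
    (h : m • normChar k K F = n • normChar k K F) : m = n := by
  have hne : Nonempty (K →ₐ[k] SeparableClosure F) :=
    (Nat.card_pos_iff.1 (hX ▸ Module.finrank_pos)).1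
  rw [normChar_eq hX, ← weilCharEquiv_apply hX, ← map_zsmul, ← map_zsmul] at h
  have := congrFun ((weilCharEquiv hX).injective h) hne.some
  simpa using this

/-- Galois acts on the lattice through permutations of the finite set of embeddings. -/
theorem finite_range_smul
    (hX : Nat.card (K →ₐ[k] SeparableClosure F) = Module.finrank k K)
    (χ : Character (weilTorus k K) (SeparableClosure F)) :
    (Set.range fun σ : Gal(SeparableClosure F/F) => σ • χ).Finite := by
  obtain ⟨f, rfl⟩ := weilChar_surjective hX χ
  refine (Set.finite_range fun π : (K →ₐ[k] SeparableClosure F) → (K →ₐ[k] SeparableClosure F) =>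
    weilChar (f ∘ π)).subset ?_
  rintro _ ⟨σ, rfl⟩
  exact ⟨galComp σ⁻¹, (smul_weilChar σ f).symm⟩

/-- Injectivity of `H¹(F, ℚ/ℤ) → H²(F, ℤ)`. When `c` is the coboundary of `m`, the lift `b` differs
from the coboundary of a lift of `m` by an integral cochain `f` with coboundary `z`. Then `ψ - f` is
a homomorphism to `ℚ` with finite range, hence zero, and `ψ` is integral. -/
theorem Corr.eq_zero_right
    (hX : Nat.card (K →ₐ[k] SeparableClosure F) = Module.finrank k K)
    {χ : Gal(SeparableClosure F/F) → AddCircle (1 : ℚ)} (h : Corr (0 : GalH1 k K F) χ) :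
    χ = 0 := by
  have hne : Nonempty (K →ₐ[k] SeparableClosure F) :=
    (Nat.card_pos_iff.1 (hX ▸ Module.finrank_pos)).1
  obtain ⟨c, b, ψ, z, hx, hb, hψ, h1, h2, h3, h4⟩ := h
  have hc : c ∈ (B1 Gal(SeparableClosure F/F) (CharGroup k K F)).addSubgroupOf _ :=
    (QuotientAddGroup.eq_zero_iff c).1 hx.symm
  obtain ⟨m, hm⟩ := hc
  obtain ⟨m, rfl⟩ := restrictHom_surjective hX m
  have hf : ∀ σ, ∃ n : ℤ, b σ - (σ • m - m) = n • normChar k K F := fun σ => by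
    apply exists_zsmul_of_restrictHom_eq_zero hX
    rw [map_sub, map_sub, h1, restrictNormOne_smul, sub_eq_zero]
    exact hm σ
  choose f hf using hf
  have hfz : ∀ σ τ, f σ + f τ - f (σ * τ) = z σ τ := fun σ τ => by
    apply normChar_zsmul_injective hX
    have e : σ • f τ • normChar k K F = f τ • normChar k K F := smul_comm _ _ _
    rw [sub_smul, add_smul, ← h3, ← e, ← hf, ← hf, ← hf, mul_smul]
    simp only [smul_sub]
    abel
  have hhom : ∀ σ τ, (fun σ => ψ σ - f σ) (σ * τ) =
      (fun σ => ψ σ - f σ) σ + (fun σ => ψ σ - f σ) τ := fun σ τ => by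
    have e1 := h4 σ τ
    rw [← hfz] at e1
    push_cast at e1
    simp only
    linarith
  have hfin : (Set.range f).Finite := by
    refine Set.Finite.of_finite_image (f := fun n : ℤ => n • normChar k K F) ?_
      (fun a _ b _ h => normChar_zsmul_injective hX h)
    refine ((hb.range_finite.sub ((finite_range_smul hX m).sub (Set.finite_singleton m)))).subset ?_
    rintro _ ⟨_, ⟨σ, rfl⟩, rfl⟩
    simp only [← hf]
    exact Set.sub_mem_sub ⟨σ, rfl⟩ (Set.sub_mem_sub ⟨σ, rfl⟩ rfl)
  have hzero := eq_zero_of_finite_range hhom (by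
    refine (hψ.range_finite.sub (hfin.image (Int.cast : ℤ → ℚ))).subset ?_
    rintro _ ⟨σ, rfl⟩
    exact Set.sub_mem_sub ⟨σ, rfl⟩ ⟨_, ⟨σ, rfl⟩, rfl⟩)
  funext σ
  rw [← h2, sub_eq_zero.1 (hzero σ)]
  exact (AddCircle.coe_eq_zero_iff 1).2 ⟨f σ, by simp⟩

/-- Injectivity of `H¹(F, T̂) → H²(F, ℤ)`, that is, vanishing of `H¹` of the permutation lattice. An
integral `ψ` corrects `b` to a cocycle `b'` in that lattice. -/
theorem Corr.eq_zero_left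
    (hX : Nat.card (K →ₐ[k] SeparableClosure F) = Module.finrank k K) {x : GalH1 k K F}
    (h : Corr x 0) : x = 0 := by
  obtain ⟨c, b, ψ, z, rfl, hb, hψ, h1, h2, h3, h4⟩ := h
  have hn : ∀ σ, ∃ n : ℤ, (n : ℚ) = ψ σ := fun σ => by
    obtain ⟨n, hn⟩ := (AddCircle.coe_eq_zero_iff 1).1 (h2 σ)
    exact ⟨n, by simpa using hn⟩
  choose n hn using hn
  have hnz : ∀ σ τ, n σ + n τ - n (σ * τ) = z σ τ := fun σ τ => by
    have := h4 σ τ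
    rw [← hn, ← hn, ← hn] at this
    exact_mod_cast this
  let b' : Gal(SeparableClosure F/F) → Character (weilTorus k K) (SeparableClosure F) :=
    fun σ => b σ - n σ • normChar k K F
  have hcoc : ∀ σ τ, b' (σ * τ) = b' σ + σ • b' τ := fun σ τ => by
    have e := h3 σ τ
    rw [← hnz, sub_smul, add_smul] at e
    have e' : σ • n τ • normChar k K F = n τ • normChar k K F := smul_comm _ _ _
    simp only [b', smul_sub, e']
    rw [sub_eq_iff_eq_add] at e
    rw [add_sub_assoc', sub_add_eq_add_sub, e]
    abel
  have hfin : (Set.range b').Finite := by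
    refine ((hb.prodMk hψ).range_finite.image fun y => y.1 - ⌊y.2⌋ • normChar k K F).subset ?_
    rintro _ ⟨σ, rfl⟩
    exact ⟨_, ⟨σ, rfl⟩, by simp [b', ← hn]⟩
  obtain ⟨N, q, hN, hq⟩ := exists_nsmul_eq_sub_smul hcoc hfin
  obtain ⟨q, rfl⟩ := weilChar_surjective hX q
  -- Here `q x` and `q (galComp σ⁻¹ x)` are congruent modulo `N`, and integer division by `N`
  -- commutes with permuting coordinates. So the rounded quotient of `q` already has coboundary
  -- `b'`.
  have hb' : ∀ σ, b' σ = weilChar (fun x => q x / N) - σ • weilChar (fun x => q x / N) := fun σ => by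
    obtain ⟨f, hf⟩ := weilChar_surjective hX (b' σ)
    have e := hq σ
    rw [← hf] at e ⊢
    rw [smul_weilChar] at e ⊢
    simp only [← weilCharEquiv_apply hX, ← map_sub, ← map_nsmul] at e ⊢
    congr 1
    have e := (weilCharEquiv hX).injective e
    funext x
    have e := congrFun e x
    simp only [Pi.smul_apply, Pi.sub_apply, nsmul_eq_mul] at e ⊢
    have : q x = q (galComp σ⁻¹ x) + N * f x := by linarith
    rw [this, Int.add_mul_ediv_left _ _ (by exact_mod_cast hN)]
    ring
  refine (QuotientAddGroup.eq_zero_iff c).2 ⟨-restrictHom (weilChar fun x => q x / N), fun σ => ?_⟩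
  have e : restrictHom (b' σ) = c.1 σ := by
    rw [← h1 σ, map_sub, map_zsmul, restrictHom_normCharacter, smul_zero, sub_zero]
  change c.1 σ = _
  rw [← e, hb', map_sub, restrictNormOne_smul, smul_neg]
  abel

/-- Every class corresponds to a homomorphism to `ℚ/ℤ` that is trivial on the elements
that fix all embeddings of `K`. -/
theorem exists_corr
    (hX : Nat.card (K →ₐ[k] SeparableClosure F) = Module.finrank k K) (x : GalH1 k K F) :
    ∃ χ : Gal(SeparableClosure F/F) → AddCircle (1 : ℚ), Corr x χ ∧
      (∀ σ τ, χ (σ * τ) = χ σ + χ τ) ∧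
      ∀ σ, (∀ x : K →ₐ[k] SeparableClosure F, galComp σ x = x) → χ σ = 0 := by
  have hne : Nonempty (K →ₐ[k] SeparableClosure F) :=
    (Nat.card_pos_iff.1 (hX ▸ Module.finrank_pos)).1
  obtain ⟨c, rfl⟩ := QuotientAddGroup.mk'_surjective _ x
  have hsurj : ∀ χ : CharGroup k K F, ∃ f, restrictHom (weilChar f) = χ := fun χ => by
    obtain ⟨b, rfl⟩ := restrictHom_surjective hX χ
    obtain ⟨f, rfl⟩ := weilChar_surjective hX b
    exact ⟨f, rfl⟩
  choose s hs using hsurj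
  let f : Gal(SeparableClosure F/F) → (K →ₐ[k] SeparableClosure F) → ℤ := fun σ => s (c.1 σ)
  have hf : IsLocallyConstant f := c.2.1.comp s
  have hz : ∀ σ τ, ∃ n : ℤ, weilChar (f σ) + σ • weilChar (f τ) - weilChar (f (σ * τ)) =
      n • normChar k K F := fun σ τ => by
    apply exists_zsmul_of_restrictHom_eq_zero hX
    rw [map_sub, map_add, restrictNormOne_smul, hs, hs, hs, c.2.2, sub_self]
  choose z hz using hz
  have hfz : ∀ σ τ x, f σ x + f τ (galComp σ⁻¹ x) - f (σ * τ) x = z σ τ := fun σ τ x => by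
    have e := hz σ τ
    rw [smul_weilChar] at e
    rw [normChar_eq hX] at e
    simp only [← weilCharEquiv_apply hX, ← map_sub, ← map_add, ← map_zsmul] at e
    simpa using congrFun ((weilCharEquiv hX).injective e) x
  let d : ℕ := Fintype.card (K →ₐ[k] SeparableClosure F)
  have hd : (d : ℤ) ≠ 0 := by exact_mod_cast Fintype.card_ne_zero
  have hd' : (d : ℚ) ≠ 0 := by exact_mod_cast hd
  -- Summing over the `d` embeddings makes the action disappear, so `S / d` is a rational cochain
  -- with the same coboundary `z` as the lift; it serves as `ψ`.
  let S : Gal(SeparableClosure F/F) → ℤ := fun σ => ∑ x, f σ x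
  have hS : ∀ σ τ, S σ + S τ - S (σ * τ) = d * z σ τ := fun σ τ => by
    have e : S τ = ∑ x, f τ (galComp σ⁻¹ x) :=
      (Fintype.sum_bijective _ (galComp_bijective σ⁻¹) _ _ fun _ => rfl).symm
    rw [e]
    simp only [S, ← Finset.sum_add_distrib, ← Finset.sum_sub_distrib, hfz]
    simp [d]
  have hψz : ∀ σ τ, (S σ : ℚ) / d + S τ / d - S (σ * τ) / d = z σ τ := fun σ τ => by
    have := hS σ τ
    field_simp
    exact_mod_cast this
  refine ⟨fun σ => ((S σ / d : ℚ) : AddCircle (1 : ℚ)), ⟨c, fun σ => weilChar (f σ),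
    fun σ => S σ / d, z, rfl, hf.comp weilChar, hf.comp fun f => ((∑ x, f x : ℤ) : ℚ) / d,
    fun σ => hs _, fun σ => rfl, hz, hψz⟩, fun σ τ => ?_, fun σ hσ => ?_⟩
  · rw [← AddCircle.coe_add, eq_comm, ← sub_eq_zero, ← AddCircle.coe_sub, hψz]
    exact (AddCircle.coe_eq_zero_iff 1).2 ⟨z σ τ, by simp⟩
  -- Removing the average leaves a cocycle in the lattice, a multiple of which is a coboundary. It
  -- vanishes at a `σ` fixing all embeddings, so `S σ / d` equals the integer `f σ x`.
  · let b' : Gal(SeparableClosure F/F) → Character (weilTorus k K) (SeparableClosure F) :=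
      fun σ => weilChar (d • f σ - S σ • 1)
    have hcoc : ∀ σ τ, b' (σ * τ) = b' σ + σ • b' τ := fun σ τ => by
      simp only [b', smul_weilChar]
      simp only [← weilCharEquiv_apply hX, ← map_add]
      congr 1
      funext x
      have e1 := hfz σ τ x
      have e2 := hS σ τ
      simp only [Pi.sub_apply, Pi.add_apply, Pi.smul_apply, Pi.one_apply, smul_eq_mul, mul_one]
      simp only [nsmul_eq_mul]
      rw [← e1] at e2
      linarith
    have hfin : (Set.range b').Finite :=
      (hf.comp fun f => weilChar (d • f - (∑ x, f x) • 1)).range_finite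
    obtain ⟨N, q, hN, hq⟩ := exists_nsmul_eq_sub_smul hcoc hfin
    obtain ⟨q, rfl⟩ := weilChar_surjective hX q
    have hinv : ∀ x : K →ₐ[k] SeparableClosure F, galComp σ⁻¹ x = x := fun x => by
      conv_lhs => rw [← hσ x]
      exact galComp_inv_galComp σ x
    have e := hq σ
    simp only [smul_weilChar, hinv, sub_self, b'] at e
    rw [← weilCharEquiv_apply hX, ← map_nsmul, EmbeddingLike.map_eq_zero_iff] at e
    have e := congrFun e hne.some
    simp only [Pi.sub_apply, Pi.smul_apply, Pi.one_apply, nsmul_eq_mul, Pi.zero_apply,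
      smul_eq_mul, mul_one, mul_eq_zero, Nat.cast_eq_zero, hN, false_or] at e
    refine (AddCircle.coe_eq_zero_iff 1).2 ⟨f σ hne.some, ?_⟩
    rw [← sub_eq_zero.1 e]
    field_simp
    simp [mul_comm]

end Connecting

/-! ### Embeddings of a Galois extension -/

theorem exists_eq_comp_algEquiv {k K Ω : Type*} [Field k] [Field K] [Algebra k K] [Normal k K]
    [Field Ω] [Algebra k Ω] (x y : K →ₐ[k] Ω) : ∃ g : Gal(K/k), ∀ a, y a = x (g a) := by
  let := x.toRingHom.toAlgebra
  have : IsScalarTower k K Ω := .of_algebraMap_eq fun a => (x.commutes a).symm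
  refine ⟨Normal.algHomEquivAut k Ω K y, fun a => ?_⟩
  exact (DFunLike.congr_fun ((Normal.algHomEquivAut k Ω K).symm_apply_apply y) a).symm

theorem card_algHom_of_isGalois {k K Ω : Type*} [Field k] [Field K] [Algebra k K]
    [FiniteDimensional k K] [IsGalois k K] [Field Ω] [Algebra k Ω] (x : K →ₐ[k] Ω) :
    Nat.card (K →ₐ[k] Ω) = Module.finrank k K := by
  let := x.toRingHom.toAlgebra
  have : IsScalarTower k K Ω := .of_algebraMap_eq fun a => (x.commutes a).symm
  rw [← IsGalois.card_aut_eq_finrank, Nat.card_congr (Normal.algHomEquivAut k Ω K)]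

/-! ### The image of an absolute Galois group in `Gal(K₀/k)`. -/

section Restriction

variable {k : Type u} [Field k] (K₀ : IntermediateField k (SeparableClosure k))
  [IsGalois k K₀] (F : Type u) [Field F] [Algebra k F]

/-- An embedding of `K₀` into the separable closure of an extension of `k`. -/
def baseEmb : K₀ →ₐ[k] SeparableClosure F :=
  (IsSepClosed.lift : SeparableClosure k →ₐ[k] SeparableClosure F).comp K₀.val

/-- The homomorphism `Γ_F → Gal(K₀/k)`. -/
def galHom : Gal(SeparableClosure F/F) →* Gal(K₀/k) :=
  (AlgEquiv.restrictNormalHom K₀).comp (galRestrict IsSepClosed.lift)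

theorem galHom_baseEmb (σ : Gal(SeparableClosure F/F)) (a : K₀) :
    σ (baseEmb K₀ F a) = baseEmb K₀ F (galHom K₀ F σ a) := by
  change _ = IsSepClosed.lift (algebraMap K₀ (SeparableClosure k) _)
  rw [galHom, MonoidHom.comp_apply]
  rw [show AlgEquiv.restrictNormalHom K₀
      (galRestrict (IsSepClosed.lift : SeparableClosure k →ₐ[k] SeparableClosure F) σ) a =
      AlgEquiv.restrictNormal _ K₀ a from rfl, AlgEquiv.restrictNormal_commutes,
    galRestrict_commutes]
  rfl

theorem galHom_isLocallyConstant [FiniteDimensional k K₀] : IsLocallyConstant (galHom K₀ F) :=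
  IsLocallyConstant.comp_continuous (f := galRestrict IsSepClosed.lift)
    (g := AlgEquiv.restrictNormalHom K₀)
    ((IsLocallyConstant.iff_continuous _).2 (InfiniteGalois.restrictNormalHom_continuous K₀))
    (galRestrict_continuous _)

variable {K₀ F}

/-- Two embeddings differ by an element of `Gal(K₀/k)`, which commutes with `galHom K₀ F σ`. Hence
`galHom` does not depend on the chosen embedding. -/
theorem galHom_apply [IsMulCommutative Gal(K₀/k)] (x : K₀ →ₐ[k] SeparableClosure F)
    (σ : Gal(SeparableClosure F/F)) (a : K₀) : σ (x a) = x (galHom K₀ F σ a) := by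
  obtain ⟨g, hg⟩ := exists_eq_comp_algEquiv (baseEmb K₀ F) x
  rw [hg, hg, galHom_baseEmb]
  exact congrArg _ (DFunLike.congr_fun (mul_comm' (galHom K₀ F σ) g) a)

theorem galHom_eq_of_forall [IsMulCommutative Gal(K₀/k)] (x : K₀ →ₐ[k] SeparableClosure F)
    {σ : Gal(SeparableClosure F/F)} {g : Gal(K₀/k)} (h : ∀ a, σ (x a) = x (g a)) :
    galHom K₀ F σ = g :=
  AlgEquiv.ext fun a => x.injective ((galHom_apply x σ a).symm.trans (h a))

theorem galHom_self [IsMulCommutative Gal(K₀/k)] :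
    galHom K₀ k = AlgEquiv.restrictNormalHom K₀ :=
  MonoidHom.ext fun σ => galHom_eq_of_forall K₀.val fun a =>
    (AlgEquiv.restrictNormal_commutes σ K₀ a).symm

theorem galHom_galRestrict [IsMulCommutative Gal(K₀/k)] {F' : Type u} [Field F'] [Algebra k F']
    [Algebra F F'] [IsScalarTower k F F']
    (j : SeparableClosure F →ₐ[F] SeparableClosure F') (σ : Gal(SeparableClosure F'/F')) :
    galHom K₀ F (galRestrict j σ) = galHom K₀ F' σ := by
  have := isScalarTower_sepClosure k F F'
  refine (galHom_eq_of_forall ((j.restrictScalars k).comp (baseEmb K₀ F)) fun a => ?_).symm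
  change σ (j _) = j _
  rw [← galRestrict_commutes]
  exact congrArg j (galHom_baseEmb K₀ F _ a)

variable (K₀ F) in
theorem card_emb [FiniteDimensional k K₀] :
    Nat.card (K₀ →ₐ[k] SeparableClosure F) = Module.finrank k K₀ :=
  card_algHom_of_isGalois (baseEmb K₀ F)

/-- If `E/F` is generated by the image of `K₀`, its degree is the order of the image of `Γ_F` in
`Gal(K₀/k)`. -/
theorem finrank_eq_card_range_galHom [IsMulCommutative Gal(K₀/k)] {E : Type u} [Field E]
    [Algebra F E] [Algebra k E] [IsScalarTower k F E] (y : K₀ →ₐ[k] E)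
    (hy : IntermediateField.adjoin F (Set.range y) = ⊤) :
    Module.finrank F E = Nat.card (galHom K₀ F).range := by
  have hsep : Algebra.IsSeparable F E := by
    have h : Algebra.IsSeparable F (⊤ : IntermediateField F E) := by
      rw [← hy, IntermediateField.isSeparable_adjoin_iff_isSeparable]
      rintro _ ⟨a, rfl⟩
      exact ((Algebra.IsSeparable.isSeparable k a).map y y.injective).tower_top F
    exact AlgEquiv.Algebra.isSeparable IntermediateField.topEquiv
  let j : E →ₐ[F] SeparableClosure F := IsSepClosed.lift
  have : IsScalarTower k F (SeparableClosure F) := inferInstance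
  let x : K₀ →ₐ[k] SeparableClosure F := (j.restrictScalars k).comp y
  have hfr : j.fieldRange = IntermediateField.adjoin F (Set.range x) := by
    rw [AlgHom.fieldRange_eq_map, ← hy, IntermediateField.adjoin_map, ← Set.range_comp]
    rfl
  rw [(AlgEquiv.ofInjectiveField j).toLinearEquiv.finrank_eq]
  change Module.finrank F j.fieldRange = _
  -- The degree is the index of the subgroup fixing the image of `E`. That image is generated by the
  -- copy of `K₀`, so the subgroup is the kernel of `galHom`.
  rw [IntermediateField.finrank_eq_fixingSubgroup_index, ← Subgroup.index_ker]
  congr 1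
  rw [hfr]
  ext σ
  rw [MonoidHom.mem_ker, IntermediateField.mem_fixingSubgroup_iff]
  constructor
  · intro h
    refine galHom_eq_of_forall x fun a => ?_
    exact h _ (IntermediateField.subset_adjoin _ _ ⟨a, rfl⟩)
  · intro h
    have hle : IntermediateField.adjoin F (Set.range x) ≤
        IntermediateField.fixedField (Subgroup.zpowers σ) := by
      rw [IntermediateField.adjoin_le_iff]
      rintro _ ⟨a, rfl⟩
      have h1 : σ (x a) = x a := by rw [galHom_apply, h]; rfl
      rintro ⟨g, hg⟩
      have hz : Subgroup.zpowers σ ≤ MulAction.stabilizer Gal(SeparableClosure F/F) (x a) := by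
        rw [Subgroup.zpowers_le]; exact h1
      exact hz hg
    intro a ha
    exact hle ha ⟨σ, Subgroup.mem_zpowers σ⟩

end Restriction

/-! ### The parametrization of `H¹(F, T̂)` by characters of `Gal(K₀/k)` -/

section Theta

variable {k : Type u} [Field k] (K₀ : IntermediateField k (SeparableClosure k))
  [FiniteDimensional k K₀] [IsGalois k K₀] (F : Type u) [Field F] [Algebra k F]

variable {K₀ F} in
theorem exists_lift (χ : Additive Gal(K₀/k) →+ AddCircle (1 : ℚ)) :
    ∃ x : GalH1 k K₀ F, Corr x fun σ => χ (.ofMul (galHom K₀ F σ)) := by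
  have hX := card_emb K₀ F
  have hlift : ∀ g : Gal(K₀/k), ∃ q : ℚ, (q : AddCircle (1 : ℚ)) = χ (.ofMul g) :=
    fun g => QuotientAddGroup.mk_surjective _
  choose t ht using hlift
  choose g hg using exists_eq_comp_algEquiv (baseEmb K₀ F)
  have hgx : ∀ σ x, g (galComp σ x) = galHom K₀ F σ * g x := fun σ x => by
    refine AlgEquiv.ext fun a => (baseEmb K₀ F).injective ?_
    change baseEmb K₀ F _ = baseEmb K₀ F _
    rw [← hg, galComp_apply, hg, galHom_baseEmb]
    rfl
  -- With `t' x = t (g x)` and `h` the image of `σ`, this is the value at `x` of the constant `t h`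
  -- plus the rational coboundary `σ t' - t'`. It is integral since `t` lifts a homomorphism, and
  -- its coboundary is that of `ψ` times the norm.
  have hn : ∀ (h : Gal(K₀/k)) (x : K₀ →ₐ[k] SeparableClosure F),
      ∃ n : ℤ, (n : ℚ) = t h + t (h⁻¹ * g x) - t (g x) := fun h x => by
    have e : ((t h + t (h⁻¹ * g x) - t (g x) : ℚ) : AddCircle (1 : ℚ)) = 0 := by
      rw [AddCircle.coe_sub, AddCircle.coe_add, ht, ht, ht, ofMul_mul, ofMul_inv, map_add, map_neg]
      abel
    obtain ⟨n, hn⟩ := (AddCircle.coe_eq_zero_iff 1).1 e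
    exact ⟨n, by simpa using hn⟩
  choose n hn using hn
  have hz : ∀ h h' : Gal(K₀/k), ∃ z : ℤ, (z : ℚ) = t h + t h' - t (h * h') := fun h h' => by
    have e : ((t h + t h' - t (h * h') : ℚ) : AddCircle (1 : ℚ)) = 0 := by
      rw [AddCircle.coe_sub, AddCircle.coe_add, ht, ht, ht, ofMul_mul, map_add, sub_self]
    obtain ⟨n, hn⟩ := (AddCircle.coe_eq_zero_iff 1).1 e
    exact ⟨n, by simpa using hn⟩
  choose z hz using hz
  let b : Gal(SeparableClosure F/F) → Character (weilTorus k K₀) (SeparableClosure F) :=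
    fun σ => weilChar (n (galHom K₀ F σ))
  have hloc := galHom_isLocallyConstant K₀ F
  have hb : ∀ σ τ, b σ + σ • b τ - b (σ * τ) =
      z (galHom K₀ F σ) (galHom K₀ F τ) • normChar k K₀ F := fun σ τ => by
    simp only [b, smul_weilChar]
    rw [normChar_eq hX]
    simp only [← weilCharEquiv_apply hX, ← map_sub, ← map_add, ← map_zsmul]
    congr 1
    funext x
    have : ((n (galHom K₀ F σ) x + n (galHom K₀ F τ) (galComp σ⁻¹ x) -
        n (galHom K₀ F (σ * τ)) x : ℤ) : ℚ) = z (galHom K₀ F σ) (galHom K₀ F τ) := by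
      push_cast
      rw [hn, hn, hn, hz, hgx, map_mul, map_inv, mul_inv_rev, mul_assoc]
      ring
    simpa using (Int.cast_injective this)
  have hc : (fun σ => restrictHom (b σ)) ∈ Z1 Gal(SeparableClosure F/F) (CharGroup k K₀ F) := by
    refine ⟨hloc.comp fun h => restrictHom (weilChar (n h)), fun σ τ => ?_⟩
    have e := congrArg restrictHom (hb σ τ)
    rw [map_sub, map_add, restrictNormOne_smul, map_zsmul, restrictHom_normCharacter, smul_zero,
      sub_eq_zero] at e
    exact e.symm
  refine ⟨H1.mk ⟨_, hc⟩, ⟨_, hc⟩, b, fun σ => t (galHom K₀ F σ),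
    fun σ τ => z (galHom K₀ F σ) (galHom K₀ F τ), rfl, hloc.comp fun h => weilChar (n h),
    hloc.comp t, fun σ => rfl, fun σ => ht _, hb, fun σ τ => ?_⟩
  simp only [hz, map_mul]

/-- The class in `H¹(F, T̂)` attached to a character of `Gal(K₀/k)`. -/
def theta : (Additive Gal(K₀/k) →+ AddCircle (1 : ℚ)) →+ GalH1 k K₀ F :=
  AddMonoidHom.mk' (fun χ => (exists_lift χ).choose) fun χ χ' => by
    have h := ((exists_lift (F := F) (χ + χ')).choose_spec).sub
      ((exists_lift (F := F) χ).choose_spec.add (exists_lift (F := F) χ').choose_spec)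
    refine sub_eq_zero.1 (Corr.eq_zero_left (card_emb K₀ F) ?_)
    convert h using 1
    funext σ
    simp

theorem corr_theta (χ : Additive Gal(K₀/k) →+ AddCircle (1 : ℚ)) :
    Corr (theta K₀ F χ) fun σ => χ (.ofMul (galHom K₀ F σ)) :=
  (exists_lift χ).choose_spec

variable {F} in
theorem Corr.eq_theta {x : GalH1 k K₀ F} {χ : Additive Gal(K₀/k) →+ AddCircle (1 : ℚ)}
    (h : Corr x fun σ => χ (.ofMul (galHom K₀ F σ))) : x = theta K₀ F χ := by
  refine sub_eq_zero.1 (Corr.eq_zero_left (card_emb K₀ F) ?_)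
  convert h.sub (corr_theta K₀ F χ) using 1
  exact (sub_self _).symm

theorem theta_eq_zero_iff (χ : Additive Gal(K₀/k) →+ AddCircle (1 : ℚ)) :
    theta K₀ F χ = 0 ↔ ∀ g ∈ (galHom K₀ F).range, χ (.ofMul g) = 0 := by
  constructor
  · rintro h _ ⟨σ, rfl⟩
    have h1 := corr_theta K₀ F χ
    rw [h] at h1
    exact congrFun (Corr.eq_zero_right (card_emb K₀ F) h1) σ
  · intro h
    refine Corr.eq_zero_left (card_emb K₀ F) ?_
    convert corr_theta K₀ F χ using 1
    funext σ
    exact (h _ ⟨σ, rfl⟩).symm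

variable [IsMulCommutative Gal(K₀/k)]

/-- The character given by `exists_corr` factors through the image of `Γ_F` in `Gal(K₀/k)`. -/
theorem theta_surjective : Function.Surjective (theta K₀ F) := by
  intro x
  obtain ⟨χ, hχ, hadd, hker⟩ := exists_corr (card_emb K₀ F) x
  let : CommGroup Gal(K₀/k) := { (inferInstance : Group Gal(K₀/k)) with mul_comm := mul_comm' }
  let ρ := galHom K₀ F
  have hker' : ∀ σ τ, ρ σ = ρ τ → χ σ = χ τ := fun σ τ h => by
    have e := hadd (σ * τ⁻¹) τ
    rw [inv_mul_cancel_right, hker (σ * τ⁻¹), zero_add] at e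
    · exact e
    · intro x
      refine AlgHom.ext fun a => ?_
      rw [galComp_apply, galHom_apply, map_mul, map_inv]
      change x ((ρ σ * (ρ τ)⁻¹) a) = _
      rw [h, mul_inv_cancel]
      rfl
  choose s hs using fun g : ρ.range => g.2
  let χ' : Additive ρ.range →+ AddCircle (1 : ℚ) := AddMonoidHom.mk'
    (fun g => χ (s g.toMul)) fun g h => by
      rw [← hadd]
      refine hker' _ _ ?_
      rw [map_mul, hs, hs, hs]
      rfl
  -- Injectivity of `ℚ/ℤ` extends the character from the image of `Γ_F` to `Gal(K₀/k)`.
  obtain ⟨χ₀, hχ₀⟩ := CharacterModule.dual_surjective_of_injective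
    (MonoidHom.toAdditive ρ.range.subtype).toIntLinearMap
    (fun a b h => Subtype.ext h) χ'
  refine ⟨χ₀, (Corr.eq_theta K₀ ?_).symm⟩
  convert hχ using 1
  funext σ
  have e := DFunLike.congr_fun hχ₀ (Additive.ofMul ⟨ρ σ, σ, rfl⟩)
  exact e.trans (hker' _ _ (hs _))

/-- In this parametrization base change is the identity on characters; only the kernel of `theta`
varies with the field. -/
theorem baseChange_theta {F' : Type u} [Field F'] [Algebra k F'] [Algebra F F']
    [IsScalarTower k F F'] (χ : Additive Gal(K₀/k) →+ AddCircle (1 : ℚ)) :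
    baseChange K₀ F F' (theta K₀ F χ) = theta K₀ F' χ := by
  refine Corr.eq_theta K₀ ?_
  convert (corr_theta K₀ F χ).baseChange (F' := F') using 1
  funext σ
  exact congrArg (fun g => χ (.ofMul g)) (galHom_galRestrict _ σ).symm

theorem theta_self_injective : Function.Injective (theta K₀ k) := by
  rw [injective_iff_map_eq_zero]
  intro χ h
  rw [theta_eq_zero_iff, galHom_self] at h
  ext g
  refine h _ ?_
  obtain ⟨σ, hσ⟩ := AlgEquiv.restrictNormalHom_surjective (SeparableClosure k) (Additive.toMul g)
  exact ⟨σ, hσ⟩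

theorem correspondsTo_iff (x : GalH1 k K₀ k) (χ : Additive Gal(K₀/k) →+ AddCircle (1 : ℚ)) :
    CorrespondsTo K₀ x χ ↔ x = theta K₀ k χ := by
  have h : CorrespondsTo K₀ x χ ↔ Corr x fun σ => χ (.ofMul (galHom K₀ k σ)) := by
    rw [galHom_self]; rfl
  rw [h]
  exact ⟨fun h => h.eq_theta K₀, fun h => h ▸ corr_theta K₀ k χ⟩

end Theta

/-! ### Extension of absolute values -/

/-- On taking `n`-th roots the linear factor `M * (n + 1)` tends to `1`. -/
theorem le_of_forall_pow_le {u D M : ℝ} (hD : 0 ≤ D)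
    (h : ∀ n : ℕ, u ^ n ≤ M * (n + 1) * D ^ n) : u ≤ D := by
  by_contra! hlt
  rcases hD.eq_or_lt with rfl | hD
  · have := h 1
    simp at this
    exact absurd this (not_le.2 hlt)
  have hr : 1 < u / D := (one_lt_div hD).2 hlt
  have h1 := (tendsto_pow_const_div_const_pow_of_one_lt 1 hr).add
    (tendsto_pow_const_div_const_pow_of_one_lt 0 hr)
  have h2 := h1.const_mul M
  rw [add_zero, mul_zero] at h2
  obtain ⟨n, hn⟩ := (h2.eventually (gt_mem_nhds one_pos)).exists
  have h3 := h n
  have hp : 0 < (u / D) ^ n := pow_pos (by positivity) n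
  have h4 : M * (n + 1) * D ^ n < u ^ n := by
    have e : M * ((n : ℝ) ^ 1 / (u / D) ^ n + (n : ℝ) ^ 0 / (u / D) ^ n) =
        M * (n + 1) / (u / D) ^ n := by ring
    rw [e, div_lt_one hp, div_pow, lt_div_iff₀ (pow_pos hD n)] at hn
    exact hn
  exact absurd h3 (not_le.2 h4)

theorem norm_algebraMap_completion {F : Type*} [Field F] (v : AbsoluteValue F ℝ) (x : F) :
    ‖algebraMap F v.Completion x‖ = v x := by
  rw [UniformSpace.Completion.algebraMap_def, UniformSpace.Completion.norm_coe]
  rfl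

section Archimedean

/-- If `v ^ c` is the usual absolute value on `ℕ`, then `v ^ c` is an absolute value. -/
theorem exists_absoluteValue_rpow {F : Type*} [Field F] (v : AbsoluteValue F ℝ) {c : ℝ}
    (hc : 0 < c) (hv : ∀ n : ℕ, v n ^ c = n) :
    ∃ v' : AbsoluteValue F ℝ, ∀ x, v' x = v x ^ c := by
  refine ⟨⟨⟨fun x => v x ^ c, fun x y => ?_⟩, fun x => Real.rpow_nonneg (v.nonneg _) _, fun x => ?_,
    fun x y => ?_⟩, fun x => rfl⟩
  · rw [map_mul, Real.mul_rpow (v.nonneg _) (v.nonneg _)]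
  · change v x ^ c = 0 ↔ _
    rw [Real.rpow_eq_zero (v.nonneg _) hc.ne', v.eq_zero]
  change v (x + y) ^ c ≤ v x ^ c + v y ^ c
  set A := v x ^ c
  set B := v y ^ c
  have hA : 0 ≤ A := Real.rpow_nonneg (v.nonneg _) _
  have hB : 0 ≤ B := Real.rpow_nonneg (v.nonneg _) _
  suffices h : v (x + y) ≤ (A + B) ^ c⁻¹ by
    have := Real.rpow_le_rpow (v.nonneg _) h hc.le
    rwa [← Real.rpow_mul (add_nonneg hA hB), inv_mul_cancel₀ hc.ne', Real.rpow_one] at this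
  refine le_of_forall_pow_le (M := 1) (by positivity) fun n => ?_
  -- Since `v ^ c` is the usual absolute value on binomial coefficients, the `c`-th power of each
  -- term is one term of the expansion of `(A + B) ^ n`.
  have hterm : ∀ m ∈ Finset.range (n + 1), v (x ^ m * y ^ (n - m) * (n.choose m : F)) ≤
      ((A + B) ^ c⁻¹) ^ n := by
    intro m hm
    rw [← Real.rpow_le_rpow_iff (v.nonneg _) (by positivity) hc, ← Real.rpow_natCast,
      ← Real.rpow_mul (by positivity), ← Real.rpow_mul (by positivity), map_mul, map_mul, map_pow,
      map_pow, Real.mul_rpow (by positivity) (v.nonneg _),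
      Real.mul_rpow (by positivity) (by positivity), hv,
      show c⁻¹ * ((n : ℝ) * c) = (n : ℝ) by field_simp, Real.rpow_natCast,
      ← Real.rpow_natCast_mul (v.nonneg _), ← Real.rpow_natCast_mul (v.nonneg _),
      mul_comm (m : ℝ), mul_comm ((n - m : ℕ) : ℝ), Real.rpow_mul_natCast (v.nonneg _),
      Real.rpow_mul_natCast (v.nonneg _), add_pow]
    exact Finset.single_le_sum (f := fun m => A ^ m * B ^ (n - m) * (n.choose m : ℝ))
      (fun i _ => by positivity) hm
  calc v (x + y) ^ n = v ((x + y) ^ n) := (map_pow v _ _).symm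
    _ ≤ ∑ m ∈ Finset.range (n + 1), v (x ^ m * y ^ (n - m) * (n.choose m : F)) := by
        rw [add_pow]; exact v.sum_le _ _
    _ ≤ ∑ m ∈ Finset.range (n + 1), ((A + B) ^ c⁻¹) ^ n := Finset.sum_le_sum hterm
    _ = _ := by simp

/-- The operator bound applied to powers gives `‖τ x‖ ≤ ‖x‖`; the same for `x⁻¹` gives equality. -/
theorem algHom_norm_eq {C : Type*} [NormedField C] [NormedAlgebra ℝ C] [FiniteDimensional ℝ C]
    (τ : C →ₐ[ℝ] ℂ) (x : C) : ‖τ x‖ = ‖x‖ := by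
  let T : C →L[ℝ] ℂ := LinearMap.toContinuousLinearMap τ.toLinearMap
  have hle : ∀ x : C, ‖τ x‖ ≤ ‖x‖ := fun x => by
    refine le_of_forall_pow_le (M := ‖T‖) (norm_nonneg _) fun n => ?_
    rw [← norm_pow, ← map_pow, ← norm_pow]
    refine (T.le_opNorm (x ^ n)).trans (mul_le_mul_of_nonneg_right ?_ (norm_nonneg _))
    exact le_mul_of_one_le_right (norm_nonneg _) (by simp)
  by_cases hx : x = 0
  · simp [hx]
  refine le_antisymm (hle x) ?_
  have h := hle x⁻¹
  rw [map_inv₀, norm_inv, norm_inv, inv_le_inv₀ (by simpa using hx) (by simpa using hx)] at h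
  exact h

/-- An absolute value that is the usual one on `ℚ` comes from a complex embedding. -/
theorem exists_complex_embedding {F : Type*} [Field F] [CharZero F] (v : AbsoluteValue F ℝ)
    (hv : ∀ q : ℚ, v q = |(q : ℝ)|) : ∃ τ : F →+* ℂ, ∀ x, ‖τ x‖ = v x := by
  let C := v.Completion
  let i : F →+* C := algebraMap F C
  have hi : ∀ x, ‖i x‖ = v x := norm_algebraMap_completion v
  let f : ℚ →+* C := i.comp (Rat.castHom F)
  have hf : ∀ q, ‖f q‖ = ‖q‖ := fun q => by
    change ‖i (q : F)‖ = _
    rw [hi, hv, ← Real.norm_eq_abs]; rfl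
  have hiso : Isometry f := AddMonoidHomClass.isometry_of_norm f hf
  have hind : IsUniformInducing (Rat.castHom ℝ) := Rat.isUniformEmbedding_coe_real.isUniformInducing
  have hden : DenseRange (Rat.castHom ℝ) := Rat.denseRange_cast
  let g : ℝ →+* C := IsDenseInducing.extendRingHom hind hden hiso.uniformContinuous
  have hgc : Continuous g :=
    (uniformContinuous_uniformly_extend hind hden hiso.uniformContinuous).continuous
  have hgq : ∀ q : ℚ, g q = f q := fun q =>
    (hind.isDenseInducing hden).extend_eq hiso.continuous q
  have hg : ∀ r, ‖g r‖ = ‖r‖ := fun r => by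
    refine hden.induction_on r (isClosed_eq (by fun_prop) (by fun_prop)) fun q => ?_
    rw [show Rat.castHom ℝ q = (q : ℝ) from rfl, hgq, hf]
    rfl
  let : Algebra ℝ C := g.toAlgebra
  let : NormedAlgebra ℝ C :=
    { norm_smul_le := fun r x => by
        rw [Algebra.smul_def, norm_mul]
        exact (congrArg (· * ‖x‖) (hg r)).le }
  -- Gelfand–Mazur: a normed field over `ℝ` is `ℝ` or `ℂ`.
  obtain ⟨τ, hfin⟩ : ∃ τ : C →ₐ[ℝ] ℂ, FiniteDimensional ℝ C := by
    rcases NormedAlgebra.Real.nonempty_algEquiv_or C with ⟨⟨e⟩⟩ | ⟨⟨e⟩⟩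
    · exact ⟨(Algebra.ofId ℝ ℂ).comp e.toAlgHom, e.symm.toLinearEquiv.finiteDimensional⟩
    · exact ⟨e.toAlgHom, e.symm.toLinearEquiv.finiteDimensional⟩
  exact ⟨τ.toRingHom.comp i, fun x => (algHom_norm_eq τ (i x)).trans (hi x)⟩

end Archimedean

variable {F L : Type u} [Field F] [Field L] [Algebra F L]

/-- The completion at a nontrivial absolute value as a nontrivially normed field. -/
@[reducible]
def completionNontriviallyNormedField {v : AbsoluteValue F ℝ} (hv : v.IsNontrivial) :
    NontriviallyNormedField v.Completion :=
  { (inferInstance : NormedField v.Completion) with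
    non_trivial := by
      obtain ⟨x, hx⟩ := hv.exists_abv_gt_one
      exact ⟨algebraMap F v.Completion x, by rwa [norm_algebraMap_completion]⟩ }

/-- By Ostrowski a power `v ^ c` is the usual absolute value on `ℚ`, so it comes from a complex
embedding. That embedding extends to `L`, and the exponent `c⁻¹` restores `v`. -/
theorem nonempty_placeOver_of_archimedean [Algebra.IsAlgebraic F L] (v : AbsoluteValue F ℝ)
    {m : ℕ} (hm : 1 < v m) : Nonempty (PlaceOver v L) := by
  have hchar : CharZero F := by
    obtain ⟨p, hp⟩ := CharP.exists F
    rcases CharP.char_is_prime_or_zero F p with hpp | rfl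
    · have : Fact p.Prime := ⟨hpp⟩
      -- Frobenius fixes the prime field, so no integer has value above `1` in characteristic `p`.
      have e : (m : F) ^ p = m := map_natCast (frobenius F p) m
      have e' : v m ^ p = v m := by rw [← map_pow, e]
      exact absurd e' (lt_self_pow₀ hm hpp.one_lt).ne'
    · exact CharP.charP_to_charZero F
  let f : AbsoluteValue ℚ ℝ := v.comp (algebraMap ℚ F).injective
  have hfq : ∀ q : ℚ, f q = v q := fun q => by
    change v (algebraMap ℚ F q) = _
    rw [eq_ratCast]
  have hf : ¬ ∀ n : ℕ, f n ≤ 1 := fun h => by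
    have := h m
    rw [hfq, Rat.cast_natCast] at this
    exact absurd this (not_le.2 hm)
  obtain ⟨c, hc, hfc⟩ := AbsoluteValue.isEquiv_iff_exists_rpow_eq.1
    (Rat.AbsoluteValue.equiv_real_of_unbounded hf)
  have hvq : ∀ q : ℚ, v q ^ c = |(q : ℝ)| := fun q => by
    rw [← hfq, ← Rat.cast_abs, ← Rat.AbsoluteValue.real_eq_abs]
    exact congrFun hfc q
  -- Follows from `v 2 ≤ 2`; it is needed because `t ↦ t ^ c⁻¹` is subadditive only for exponents at
  -- most `1`.
  have hc1 : 1 ≤ c := by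
    have h2 := hvq 2
    have h3 : v 2 ≤ 2 := by
      have := v.add_le 1 1
      rw [map_one] at this
      norm_num at this
      exact this
    rw [show ((2 : ℚ) : F) = 2 by norm_num, show |((2 : ℚ) : ℝ)| = 2 by norm_num] at h2
    by_contra! hlt
    have h4 : v 2 ^ c ≤ 2 ^ c := Real.rpow_le_rpow (v.nonneg _) h3 hc.le
    have h5 : (2 : ℝ) ^ c < 2 ^ (1 : ℝ) := Real.rpow_lt_rpow_of_exponent_lt one_lt_two hlt
    rw [Real.rpow_one] at h5
    linarith
  obtain ⟨v', hv'⟩ := exists_absoluteValue_rpow v hc fun n => by simpa using hvq n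
  obtain ⟨τ, hτ⟩ := exists_complex_embedding v' fun q => by rw [hv', hvq]
  let := τ.toAlgebra
  let j : L →ₐ[F] ℂ := IsAlgClosed.lift
  have hc' : c⁻¹ ≤ 1 := inv_le_one_of_one_le₀ hc1
  have hc0 : 0 < c⁻¹ := inv_pos.2 hc
  refine ⟨⟨⟨⟨fun x => ‖j x‖ ^ c⁻¹, fun x y => ?_⟩, fun x => by positivity, fun x => ?_,
    fun x y => ?_⟩, ⟨?_⟩⟩⟩
  · rw [map_mul, norm_mul, Real.mul_rpow (norm_nonneg _) (norm_nonneg _)]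
  · change ‖j x‖ ^ c⁻¹ = 0 ↔ _
    rw [Real.rpow_eq_zero (norm_nonneg _) hc0.ne', norm_eq_zero, map_eq_zero]
  · change ‖j (x + y)‖ ^ c⁻¹ ≤ ‖j x‖ ^ c⁻¹ + ‖j y‖ ^ c⁻¹
    rw [map_add]
    refine (Real.rpow_le_rpow (norm_nonneg _) (norm_add_le _ _) hc0.le).trans ?_
    exact_mod_cast NNReal.rpow_add_le_add_rpow ‖j x‖₊ ‖j y‖₊ hc0.le hc'
  · ext x
    change ‖j (algebraMap F L x)‖ ^ c⁻¹ = v x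
    rw [j.commutes, show algebraMap F ℂ x = τ x from rfl, hτ, hv', ← Real.rpow_mul (v.nonneg _),
      mul_inv_cancel₀ hc.ne', Real.rpow_one]

/-- The spectral norm on the algebraic closure of the completion is multiplicative and extends `v`;
it is pulled back along an embedding of `L`. -/
theorem nonempty_placeOver_of_nonarchimedean [Algebra.IsAlgebraic F L] {v : AbsoluteValue F ℝ}
    (hv : v.IsNontrivial) (h : ∀ m : ℕ, v m ≤ 1) : Nonempty (PlaceOver v L) := by
  let := completionNontriviallyNormedField hv
  have : IsUltrametricDist v.Completion :=
    IsUltrametricDist.isUltrametricDist_of_forall_norm_natCast_le_one fun n => by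
      rw [← map_natCast (algebraMap F v.Completion), norm_algebraMap_completion]
      exact h n
  let j : L →ₐ[F] AlgebraicClosure v.Completion := IsAlgClosed.lift
  let N := spectralMulAlgNorm v.Completion (AlgebraicClosure v.Completion)
  refine ⟨⟨(MulRingNorm.mulRingNormEquivAbsoluteValue N.toMulRingNorm).comp j.injective, ⟨?_⟩⟩⟩
  ext x
  change N (j (algebraMap F L x)) = v x
  rw [j.commutes, IsScalarTower.algebraMap_apply F v.Completion (AlgebraicClosure v.Completion)]
  exact (spectralNorm_extends _).trans (norm_algebraMap_completion v x)

/-- A nontrivial absolute value extends to every algebraic extension. -/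
theorem nonempty_placeOver [Algebra.IsAlgebraic F L] {v : AbsoluteValue F ℝ}
    (hv : v.IsNontrivial) : Nonempty (PlaceOver v L) := by
  by_cases h : ∀ m : ℕ, v m ≤ 1
  · exact nonempty_placeOver_of_nonarchimedean hv h
  · push Not at h
    obtain ⟨m, hm⟩ := h
    exact nonempty_placeOver_of_archimedean v hm

theorem PlaceOver.isNontrivial {v : AbsoluteValue F ℝ} (hv : v.IsNontrivial)
    (w : PlaceOver v L) : w.abs.IsNontrivial := by
  obtain ⟨x, hx, hx'⟩ := hv
  refine ⟨algebraMap F L x, by simpa using hx, ?_⟩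
  have := DFunLike.congr_fun w.liesOver.comp_eq x
  change w.abs (algebraMap F L x) = v x at this
  rwa [this]

/-! ### Completions of compositums -/

theorem PlaceOver.algebraMap_algebraMap {v : AbsoluteValue F ℝ} (w : PlaceOver v L) (x : F) :
    algebraMap v.Completion w.abs.Completion (algebraMap F v.Completion x) =
      algebraMap L w.abs.Completion (algebraMap F L x) := by
  rw [← IsScalarTower.algebraMap_apply F v.Completion w.abs.Completion,
    ← IsScalarTower.algebraMap_apply F L w.abs.Completion]

/-- `L_w` is spanned over `F_v` by `L`. -/
theorem PlaceOver.span_range_eq_top [FiniteDimensional F L] {v : AbsoluteValue F ℝ}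
    (hv : v.IsNontrivial) (w : PlaceOver v L) :
    Submodule.span v.Completion (Set.range (algebraMap L w.abs.Completion)) = ⊤ := by
  let := completionNontriviallyNormedField hv
  have : ContinuousSMul v.Completion w.abs.Completion :=
    continuousSMul_of_algebraMap _ _ UniformSpace.Completion.continuous_map
  let b := Module.finBasis F L
  let V := Submodule.span v.Completion (Set.range fun n => algebraMap L w.abs.Completion (b n))
  have hV : ∀ l, algebraMap L w.abs.Completion l ∈ V := fun l => by
    rw [← b.sum_repr l, map_sum]
    refine V.sum_mem fun n _ => ?_
    rw [Algebra.smul_def, map_mul, ← w.algebraMap_algebraMap, ← Algebra.smul_def]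
    exact V.smul_mem _ (Submodule.subset_span ⟨n, rfl⟩)
  have : FiniteDimensional v.Completion V := FiniteDimensional.span_of_finite _ (Set.finite_range _)
  -- A finite-dimensional subspace over a complete field is closed, and this one contains the dense
  -- image of `L`.
  have hcl : IsClosed (V : Set w.abs.Completion) := Submodule.closed_of_finiteDimensional V
  have htop : V = ⊤ := by
    rw [eq_top_iff]
    intro x _
    refine UniformSpace.Completion.induction_on x hcl fun a => ?_
    have := hV a.ofAbs
    rwa [UniformSpace.Completion.algebraMap_def] at this
  rw [eq_top_iff, ← htop]
  exact Submodule.span_mono (Set.range_comp_subset_range b (algebraMap L w.abs.Completion))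

theorem PlaceOver.adjoin_eq_top [FiniteDimensional F L] {v : AbsoluteValue F ℝ}
    (hv : v.IsNontrivial) (w : PlaceOver v L) {S : Set L}
    (hS : IntermediateField.adjoin F S = ⊤) :
    IntermediateField.adjoin v.Completion (algebraMap L w.abs.Completion '' S) = ⊤ := by
  set D := IntermediateField.adjoin v.Completion (algebraMap L w.abs.Completion '' S)
  have hle : IntermediateField.adjoin F S ≤
      (D.restrictScalars F).comap (IsScalarTower.toAlgHom F L w.abs.Completion) := by
    rw [IntermediateField.adjoin_le_iff]
    intro s hs
    exact IntermediateField.subset_adjoin _ _ ⟨s, hs, rfl⟩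
  rw [hS] at hle
  have h2 : (⊤ : Submodule v.Completion w.abs.Completion) ≤ D.toSubalgebra.toSubmodule := by
    rw [← w.span_range_eq_top hv, Submodule.span_le]
    rintro _ ⟨l, rfl⟩
    exact hle (IntermediateField.mem_top (x := l))
  exact eq_top_iff.2 fun x _ => h2 trivial

/-- The local degrees of an extension generated by the image of `K₀`. -/
theorem PlaceOver.finrank_completion {k : Type u} [Field k]
    {K₀ : IntermediateField k (SeparableClosure k)} [IsGalois k K₀]
    [IsMulCommutative Gal(K₀/k)] [Algebra k F] [Algebra k L] [IsScalarTower k F L]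
    [FiniteDimensional F L] (y : K₀ →ₐ[k] L) (hy : IntermediateField.adjoin F (Set.range y) = ⊤)
    {v : AbsoluteValue F ℝ} (hv : v.IsNontrivial) (w : PlaceOver v L) :
    Module.finrank v.Completion w.abs.Completion = Nat.card (galHom K₀ v.Completion).range := by
  refine finrank_eq_card_range_galHom
    ((IsScalarTower.toAlgHom k L w.abs.Completion).comp y) ?_
  have h := w.adjoin_eq_top hv hy
  rwa [← Set.range_comp] at h

/-- The degree is the same at all places above `v`. One such place must exist, since an empty
supremum would be `0`. -/
theorem localExp_eq {k : Type u} [Field k]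
    {K₀ : IntermediateField k (SeparableClosure k)} [IsGalois k K₀]
    [IsMulCommutative Gal(K₀/k)] [Algebra k F] [Algebra k L] [IsScalarTower k F L]
    [FiniteDimensional F L] (y : K₀ →ₐ[k] L) (hy : IntermediateField.adjoin F (Set.range y) = ⊤)
    {v : AbsoluteValue F ℝ} (hv : v.IsNontrivial) (p : ℕ) :
    localExp p v L = padicValNat p (Nat.card (galHom K₀ v.Completion).range) := by
  have := nonempty_placeOver (L := L) hv
  simp only [localExp, PlaceOver.finrank_completion y hy hv, ciSup_const]

/-! ### Cyclic groups of prime power order -/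

/-- The powers with exponent the index lie in `H`, and in a cyclic group there are as many of them
as elements of `H`. -/
theorem IsCyclic.mem_iff_exists_pow_index {G : Type*} [Group G] [IsCyclic G] [Finite G]
    (H : Subgroup G) (h : G) : h ∈ H ↔ ∃ g, g ^ H.index = h := by
  let : CommGroup G := IsCyclic.commGroup
  have hle : (powMonoidHom H.index : G →* G).range ≤ H := by
    rintro _ ⟨g, rfl⟩
    exact H.pow_index_mem g
  have hcard : Nat.card (powMonoidHom H.index : G →* G).range = Nat.card H := by
    rw [IsCyclic.card_powMonoidHom_range, Nat.gcd_eq_right H.index_dvd_card]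
    exact Nat.div_eq_of_eq_mul_left (Nat.pos_of_ne_zero H.index_ne_zero_of_finite)
      H.card_mul_index.symm
  have h := Subgroup.eq_of_le_of_card_ge hle hcard.ge
  exact ⟨fun hh => by rwa [← h] at hh, fun hh => h ▸ hh⟩

theorem exists_addEquiv_of_ker_eq {A B C : Type*} [AddCommGroup A] [AddCommGroup B]
    [AddCommGroup C] {f : A →+ B} {g : A →+ C} (hf : Function.Surjective f)
    (hg : Function.Surjective g) (h : ∀ a, f a = 0 ↔ g a = 0) :
    ∃ Φ : B ≃+ C, ∀ a, Φ (f a) = g a := by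
  have hker : f.ker = g.ker := by ext a; exact h a
  let e := QuotientAddGroup.quotientKerEquivOfSurjective f hf
  refine ⟨e.symm.trans ((QuotientAddGroup.quotientAddEquivOfEq hker).trans
    (QuotientAddGroup.quotientKerEquivOfSurjective g hg)), fun a => ?_⟩
  have : e.symm (f a) = (a : A ⧸ f.ker) := e.symm_apply_eq.2 rfl
  simp only [AddEquiv.trans_apply, this]
  rfl

/-! ### Reductions between the groups `ℤ/p^s`. -/

section Proj

variable {p : ℕ}

/-- The cast is a ring homomorphism because `p ^ t` divides `p ^ s`; this is the source of the
bounds on exponents carried below. -/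
theorem proj_eq_castHom {s t : ℕ} (h : t ≤ s) (a : ZMod (p ^ s)) :
    proj t a = ZMod.castHom (pow_dvd_pow p h) (ZMod (p ^ t)) a := rfl

theorem proj_surjective {s t : ℕ} (h : t ≤ s) :
    Function.Surjective (proj t : ZMod (p ^ s) → ZMod (p ^ t)) :=
  ZMod.castHom_surjective (pow_dvd_pow p h)

theorem proj_proj {s t r : ℕ} (hts : t ≤ s) (hrt : r ≤ t) (a : ZMod (p ^ s)) :
    proj r (proj t a) = proj r a := by
  rw [proj_eq_castHom hrt, proj_eq_castHom hts, proj_eq_castHom (hrt.trans hts),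
    ← RingHom.comp_apply, ZMod.castHom_comp]

theorem proj_eq_of_le {s s' t r : ℕ} (hs : t ≤ s) (hs' : t ≤ s') (hrt : r ≤ t)
    {a : ZMod (p ^ s)} {b : ZMod (p ^ s')} (h : proj t a = proj t b) : proj r a = proj r b := by
  rw [← proj_proj hs hrt, h, proj_proj hs' hrt]

theorem proj_eq_zero_iff (hp : p.Prime) {e h : ℕ} (hh : h ≤ e) (n : ZMod (p ^ e)) :
    proj h n = 0 ↔ p ^ (e - h) • n = 0 := by
  have : NeZero (p ^ e) := ⟨pow_ne_zero _ hp.ne_zero⟩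
  obtain ⟨m, rfl⟩ := ZMod.natCast_zmod_surjective n
  rw [proj_eq_castHom hh, map_natCast, ZMod.natCast_eq_zero_iff, nsmul_eq_mul, ← Nat.cast_mul,
    ZMod.natCast_eq_zero_iff, ← Nat.sub_add_cancel hh, pow_add, Nat.add_sub_cancel]
  exact (Nat.mul_dvd_mul_iff_left (pow_pos hp.pos _)).symm

end Proj

/-! ### The exponent of an extension of `k` -/

section Exponent

variable {k : Type u} [Field k] {p e : ℕ} {K₀ : IntermediateField k (SeparableClosure k)}
  [IsGalois k K₀]

variable (p K₀) in
/-- The exponent of the order of the image of `Γ_F` in `Gal(K₀/k)`. -/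
def fieldExp (F : Type u) [Field F] [Algebra k F] : ℕ :=
  padicValNat p (Nat.card (galHom K₀ F).range)

variable [FiniteDimensional k K₀]

theorem card_range_galHom (hp : p.Prime) (hdeg : Module.finrank k K₀ = p ^ e) (F : Type u)
    [Field F] [Algebra k F] :
    fieldExp p K₀ F ≤ e ∧ Nat.card (galHom K₀ F).range = p ^ fieldExp p K₀ F := by
  have h := Subgroup.card_subgroup_dvd_card (galHom K₀ F).range
  rw [IsGalois.card_aut_eq_finrank, hdeg] at h
  obtain ⟨r, hr, hr'⟩ := (Nat.dvd_prime_pow hp).1 h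
  have : Fact p.Prime := ⟨hp⟩
  rw [fieldExp, hr', padicValNat.prime_pow]
  exact ⟨hr, rfl⟩

theorem fieldExp_le_of_algebra [IsMulCommutative Gal(K₀/k)] (hp : p.Prime)
    (hdeg : Module.finrank k K₀ = p ^ e) (F F' : Type u) [Field F] [Algebra k F] [Field F']
    [Algebra k F'] [Algebra F F'] [IsScalarTower k F F'] :
    fieldExp p K₀ F' ≤ fieldExp p K₀ F := by
  have hle : (galHom K₀ F').range ≤ (galHom K₀ F).range := by
    rintro _ ⟨σ, rfl⟩
    exact ⟨galRestrict IsSepClosed.lift σ, galHom_galRestrict _ σ⟩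
  have h := Subgroup.card_dvd_of_le hle
  rw [(card_range_galHom hp hdeg F).2, (card_range_galHom hp hdeg F').2] at h
  exact (Nat.pow_dvd_pow_iff_le_right hp.one_lt).1 h

/-- The image of `Γ_F`, of order `p^h`, consists of the `p^(e-h)`-th powers. A character is trivial
on it exactly when `p^(e-h)` kills the character, hence when `p^(e-h)` kills `n`. -/
theorem theta_symm_eq_zero_iff (hcyc : IsCyclic Gal(K₀/k)) (hp : p.Prime)
    (hdeg : Module.finrank k K₀ = p ^ e)
    (γ : (Additive Gal(K₀/k) →+ AddCircle (1 : ℚ)) ≃+ ZMod (p ^ e)) (F : Type u) [Field F]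
    [Algebra k F] (n : ZMod (p ^ e)) :
    theta K₀ F (γ.symm n) = 0 ↔ proj (fieldExp p K₀ F) n = 0 := by
  obtain ⟨hle, hcard⟩ := card_range_galHom hp hdeg F
  have hindex : (galHom K₀ F).range.index = p ^ (e - fieldExp p K₀ F) := by
    have h := (galHom K₀ F).range.card_mul_index
    rw [IsGalois.card_aut_eq_finrank, hdeg, hcard] at h
    refine Nat.eq_of_mul_eq_mul_left (pow_pos hp.pos (fieldExp p K₀ F)) ?_
    rw [h, ← pow_add, Nat.add_sub_cancel' hle]
  rw [proj_eq_zero_iff hp hle, theta_eq_zero_iff, ← EmbeddingLike.map_eq_zero_iff (f := γ.symm),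
    map_nsmul, ← hindex]
  constructor
  · intro h
    refine AddMonoidHom.ext fun g => ?_
    exact (map_nsmul (γ.symm n) _ g).symm.trans
      (h _ ((IsCyclic.mem_iff_exists_pow_index _ _).2 ⟨g.toMul, rfl⟩))
  · intro h g hg
    obtain ⟨g, rfl⟩ := (IsCyclic.mem_iff_exists_pow_index _ _).1 hg
    rw [ofMul_pow, map_nsmul]
    exact DFunLike.congr_fun h (.ofMul g)

theorem theta_symm_eq_iff (hcyc : IsCyclic Gal(K₀/k)) (hp : p.Prime)
    (hdeg : Module.finrank k K₀ = p ^ e)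
    (γ : (Additive Gal(K₀/k) →+ AddCircle (1 : ℚ)) ≃+ ZMod (p ^ e)) (F : Type u) [Field F]
    [Algebra k F] (n n' : ZMod (p ^ e)) :
    theta K₀ F (γ.symm n) = theta K₀ F (γ.symm n') ↔
      proj (fieldExp p K₀ F) n = proj (fieldExp p K₀ F) n' := by
  rw [← sub_eq_zero, ← map_sub, ← map_sub, theta_symm_eq_zero_iff hcyc hp hdeg,
    proj_eq_castHom (card_range_galHom hp hdeg F).1, map_sub, sub_eq_zero]
  rfl

/-- Each local class `y_v` is itself `theta` of a character of `Gal(K₀/k)`, so it may be replaced by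
some `n` modulo `p^e`. Equality in `H¹(K_{i,w}, T̂)` is then a congruence. -/
theorem theta_mem_selmerGroup_iff (hcyc : IsCyclic Gal(K₀/k)) (hp : p.Prime)
    (hdeg : Module.finrank k K₀ = p ^ e)
    (γ : (Additive Gal(K₀/k) →+ AddCircle (1 : ℚ)) ≃+ ZMod (p ^ e)) {ι : Type*} {E : ι → Type u}
    [∀ i, Field (E i)] [∀ i, Algebra k (E i)] (A : ι → ZMod (p ^ e)) :
    (fun i => theta K₀ (E i) (γ.symm (A i))) ∈ selmerGroup k K₀ E ↔
      ∀ v : Place k, ∃ n : ZMod (p ^ e), ∀ i (w : PlaceOver v.abs (E i)),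
        proj (fieldExp p K₀ w.abs.Completion) n = proj (fieldExp p K₀ w.abs.Completion) (A i) := by
  have hcomm : IsMulCommutative Gal(K₀/k) := IsCyclic.isMulCommutative
  have hloc : ∀ (v : Place k) (i : ι) (w : PlaceOver v.abs (E i)) (n : ZMod (p ^ e)),
      baseChange K₀ (E i) w.abs.Completion (theta K₀ (E i) (γ.symm (A i))) =
        baseChange K₀ v.abs.Completion w.abs.Completion (theta K₀ v.abs.Completion (γ.symm n)) ↔
      proj (fieldExp p K₀ w.abs.Completion) n =
        proj (fieldExp p K₀ w.abs.Completion) (A i) := by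
    intro v i w n
    rw [baseChange_theta, baseChange_theta, theta_symm_eq_iff hcyc hp hdeg, eq_comm]
  constructor
  · rintro ⟨y, hy⟩ v
    obtain ⟨χ, hχ⟩ := theta_surjective K₀ v.abs.Completion (y v)
    refine ⟨γ χ, fun i w => (hloc v i w _).1 ?_⟩
    rw [γ.symm_apply_apply, hχ]
    exact hy v i w
  · intro h
    choose n hn using h
    exact ⟨fun v => theta K₀ v.abs.Completion (γ.symm (n v)),
      fun v i w => (hloc v i w _).2 (hn v i w)⟩

end Exponent

/-! ### The exponents of the compositum and of its completions -/

section Compositum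

variable {k : Type u} [Field k] {p e : ℕ} {K₀ : IntermediateField k (SeparableClosure k)}
  {K₁ : IntermediateField k (SeparableClosure k)}

variable (K₀ K₁) in
/-- The embedding of `K₀` into `K₀ K₁`. -/
def toCompositum : K₀ →ₐ[k] compositum K₀ K₁ :=
  (IntermediateField.inclusion (le_sup_left : K₀ ≤ K₀ ⊔ K₁) :)

theorem adjoin_range_toCompositum :
    IntermediateField.adjoin K₁ (Set.range (toCompositum K₀ K₁)) = ⊤ := by
  set D := IntermediateField.adjoin K₁ (Set.range (toCompositum K₀ K₁))
  have hle : K₀ ⊔ K₁ ≤ (IntermediateField.lift D).restrictScalars k := by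
    refine sup_le (fun x hx => ?_) fun x hx => ?_
    · exact (IntermediateField.mem_lift (toCompositum K₀ K₁ ⟨x, hx⟩)).2
        (IntermediateField.subset_adjoin _ _ ⟨⟨x, hx⟩, rfl⟩)
    · exact (IntermediateField.lift D).algebraMap_mem ⟨x, hx⟩
  refine eq_top_iff.2 fun x _ => ?_
  exact (IntermediateField.mem_lift x).1 (hle x.2)

end Compositum

/-! ### Local conditions as congruences. -/

section Places

theorem Place.isNontrivial {k : Type u} [Field k] (v : Place k) : v.abs.IsNontrivial :=
  (Quotient.out v).2

theorem isScalarTower_completion {k F : Type u} [Field k] [Field F] [Algebra k F]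
    (v : AbsoluteValue F ℝ) : IsScalarTower k F v.Completion := inferInstance

section Global

variable {k : Type u} [Field k] {p e : ℕ} {K₀ : IntermediateField k (SeparableClosure k)}
  {ι : Type*} {K' : ι → IntermediateField k (SeparableClosure k)}

theorem le_delta_iff [Fintype ι] {n : ZMod (p ^ maxExp p K₀ K')} {a : SumZMod p K₀ K'}
    {i : ι} {r : ℕ} (hr : r ≤ globalExp p K₀ K' i) : r ≤ delta n a i ↔ proj r n = proj r (a i) := by
  have hmax : globalExp p K₀ K' i ≤ maxExp p K₀ K' :=
    Finset.le_sup (f := globalExp p K₀ K') (Finset.mem_univ i)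
  have hbdd : BddAbove {r | r ≤ globalExp p K₀ K' i ∧ proj r n = proj r (a i)} :=
    ⟨_, fun r hr => hr.1⟩
  constructor
  · intro h
    have hmem : delta n a i ∈ {r | r ≤ globalExp p K₀ K' i ∧ proj r n = proj r (a i)} := by
      -- The supremum is attained: `0` belongs to the set because `ℤ/p^0` is trivial.
      refine Nat.sSup_mem ⟨0, Nat.zero_le _, ?_⟩ hbdd
      have : Subsingleton (ZMod (p ^ 0)) := by rw [pow_zero]; infer_instance
      exact Subsingleton.elim _ _
    exact proj_eq_of_le (hmem.1.trans hmax) hmem.1 h hmem.2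
  · exact fun h => le_csSup hbdd ⟨hr, h⟩

variable [IsGalois k K₀] [IsMulCommutative Gal(K₀/k)]

theorem globalExp_eq (i : ι) : globalExp p K₀ K' i = fieldExp p K₀ (K' i) := by
  rw [globalExp, fieldExp, finrank_eq_card_range_galHom _ adjoin_range_toCompositum]

theorem globalExp_le [FiniteDimensional k K₀] (hp : p.Prime)
    (hdeg : Module.finrank k K₀ = p ^ e) (i : ι) : globalExp p K₀ K' i ≤ e := by
  rw [globalExp_eq]
  exact (card_range_galHom hp hdeg _).1

end Global

variable {k : Type u} [Field k] {p e : ℕ} {K₀ : IntermediateField k (SeparableClosure k)}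
  [FiniteDimensional k K₀] [IsGalois k K₀] [IsMulCommutative Gal(K₀/k)]
  {ι : Type*} {K' : ι → IntermediateField k (SeparableClosure k)}
  [∀ i, FiniteDimensional k (K' i)]

theorem expOver_eq {v : Place k} (i : ι) (w : PlaceOver v.abs (K' i)) :
    expOver p K₀ K' i w = fieldExp p K₀ w.abs.Completion := by
  have : FiniteDimensional k (compositum K₀ (K' i)) :=
    (inferInstance : FiniteDimensional k (K₀ ⊔ K' i : IntermediateField k (SeparableClosure k)))
  have : FiniteDimensional (K' i) (compositum K₀ (K' i)) :=
    FiniteDimensional.right k (K' i) (compositum K₀ (K' i))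
  exact localExp_eq (toCompositum K₀ (K' i)) adjoin_range_toCompositum
    (w.isNontrivial v.isNontrivial) p

theorem expAt_eq (v : Place k) : expAt p K₀ v = fieldExp p K₀ v.abs.Completion := by
  refine localExp_eq (AlgHom.id k K₀) ?_ v.isNontrivial p
  exact eq_top_iff.2 fun x _ => IntermediateField.subset_adjoin _ _ ⟨x, rfl⟩

theorem expOver_le_globalExp (hp : p.Prime) (hdeg : Module.finrank k K₀ = p ^ e)
    {v : Place k} (i : ι) (w : PlaceOver v.abs (K' i)) :
    expOver p K₀ K' i w ≤ globalExp p K₀ K' i := by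
  have := isScalarTower_completion (k := k) w.abs
  rw [expOver_eq, globalExp_eq]
  exact fieldExp_le_of_algebra hp hdeg _ _

theorem expOver_le_expAt (hp : p.Prime) (hdeg : Module.finrank k K₀ = p ^ e)
    {v : Place k} (i : ι) (w : PlaceOver v.abs (K' i)) :
    expOver p K₀ K' i w ≤ expAt p K₀ v := by
  rw [expOver_eq, expAt_eq]
  exact fieldExp_le_of_algebra hp hdeg _ _

theorem expAt_le (hp : p.Prime) (hdeg : Module.finrank k K₀ = p ^ e) (v : Place k) :
    expAt p K₀ v ≤ e := by
  rw [expAt_eq]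
  exact (card_range_galHom hp hdeg _).1

theorem expOver_le_expMaxAt (hp : p.Prime) (hdeg : Module.finrank k K₀ = p ^ e)
    {v : Place k} (i : ι) (w : PlaceOver v.abs (K' i)) :
    expOver p K₀ K' i w ≤ expMaxAt p K₀ K' v i :=
  le_ciSup (f := fun w => expOver p K₀ K' i w)
    ⟨globalExp p K₀ K' i, Set.forall_mem_range.2 fun w => expOver_le_globalExp hp hdeg i w⟩ w

theorem exists_expOver_eq_expMaxAt (hp : p.Prime) (hdeg : Module.finrank k K₀ = p ^ e)
    (v : Place k) (i : ι) :
    ∃ w : PlaceOver v.abs (K' i), expOver p K₀ K' i w = expMaxAt p K₀ K' v i := by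
  have := nonempty_placeOver (L := K' i) v.isNontrivial
  exact Nat.sSup_mem (Set.range_nonempty fun w => expOver p K₀ K' i w)
    ⟨globalExp p K₀ K' i, Set.forall_mem_range.2 fun w => expOver_le_globalExp hp hdeg i w⟩

/-- The maximum `e_i(v)` is attained at some `w`, so the congruence modulo `p^{e_i(v)}` is the
strongest among those for `w ∣ v`. Since `e_i(w) ≤ e(v) ≤ e`, taking `n` modulo `p^{e(v)}` or modulo
`p^e` makes no difference. -/
theorem locallyDiagonalAt_iff (hp : p.Prime) (hdeg : Module.finrank k K₀ = p ^ e)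
    (a : SumZMod p K₀ K') (v : Place k) :
    LocallyDiagonalAt a v ↔ ∃ n : ZMod (p ^ e), ∀ i (w : PlaceOver v.abs (K' i)),
      proj (expOver p K₀ K' i w) n = proj (expOver p K₀ K' i w) (a i) := by
  have hat := expAt_le hp hdeg v
  constructor
  · rintro ⟨n, hn⟩
    obtain ⟨N, rfl⟩ := proj_surjective hat n
    refine ⟨N, fun i w => ?_⟩
    obtain ⟨w', hw'⟩ := exists_expOver_eq_expMaxAt (K' := K') hp hdeg v i
    rw [← proj_proj hat (expOver_le_expAt hp hdeg i w)]
    refine proj_eq_of_le ?_ ?_ (expOver_le_expMaxAt hp hdeg i w) (hn i)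
    · exact hw' ▸ expOver_le_expAt hp hdeg i w'
    · exact hw' ▸ expOver_le_globalExp hp hdeg i w'
  · rintro ⟨N, hN⟩
    refine ⟨proj _ N, fun i => ?_⟩
    obtain ⟨w, hw⟩ := exists_expOver_eq_expMaxAt (K' := K') hp hdeg v i
    rw [← hw, proj_proj hat (expOver_le_expAt hp hdeg i w)]
    exact hN i w

theorem mem_groupG_iff [Fintype ι] (hp : p.Prime)
    (hdeg : Module.finrank k K₀ = p ^ e) (a : SumZMod p K₀ K') :
    a ∈ groupG p K₀ K' ↔ ∀ v : Place k, ∃ n : ZMod (p ^ e), ∀ i (w : PlaceOver v.abs (K' i)),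
      proj (expOver p K₀ K' i w) n = proj (expOver p K₀ K' i w) (a i) := by
  have hmax : ∀ i, globalExp p K₀ K' i ≤ maxExp p K₀ K' := fun i =>
    Finset.le_sup (f := globalExp p K₀ K') (Finset.mem_univ i)
  have hmaxe : maxExp p K₀ K' ≤ e := Finset.sup_le fun i _ => globalExp_le hp hdeg i
  have homega : ∀ (v : Place k) (n : ZMod (p ^ maxExp p K₀ K')), v ∈ omegaSet n a ↔
      ∀ i (w : PlaceOver v.abs (K' i)),
        proj (expOver p K₀ K' i w) n = proj (expOver p K₀ K' i w) (a i) := by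
    intro v n
    constructor
    · intro h i w
      have hw := expOver_le_globalExp hp hdeg i w
      -- For `i` in `I_n(a)` the congruence holds modulo `p^{e_i}`, hence modulo every `p^{e_i(w)}`;
      -- otherwise it is the bound by `delta`.
      by_cases hi : i ∈ indexSet n a
      · rw [← proj_proj (hmax i) hw, show proj (globalExp p K₀ K' i) n = a i from hi]
      · exact (le_delta_iff hw).1 (h i hi w)
    · intro h i _ w
      exact (le_delta_iff (expOver_le_globalExp hp hdeg i w)).2 (h i w)
  change (⋃ n : ZMod (p ^ maxExp p K₀ K'), omegaSet n a) = Set.univ ↔ _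
  simp only [Set.eq_univ_iff_forall, Set.mem_iUnion, homega]
  refine forall_congr' fun v => ⟨?_, ?_⟩
  · rintro ⟨n, hn⟩
    obtain ⟨N, rfl⟩ := proj_surjective hmaxe n
    refine ⟨N, fun i w => ?_⟩
    rw [← proj_proj hmaxe ((expOver_le_globalExp hp hdeg i w).trans (hmax i))]
    exact hn i w
  · rintro ⟨N, hN⟩
    refine ⟨proj _ N, fun i w => ?_⟩
    rw [proj_proj hmaxe ((expOver_le_globalExp hp hdeg i w).trans (hmax i))]
    exact hN i w

end Places

end

end Multinorm

/-! ### The isomorphisms `Φ` and the comparison of the groups. -/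

open Multinorm
theorem lemma4p17 {k : Type u} [Field k] (hk : IsGlobalField k)
    (p e : ℕ) (hp : p.Prime)
    (K₀ : IntermediateField k (SeparableClosure k)) [FiniteDimensional k K₀] [IsGalois k K₀]
    (hcyc : IsCyclic Gal(K₀/k)) (hdeg : Module.finrank k K₀ = p ^ e)
    (m : ℕ) (K' : Fin m → IntermediateField k (SeparableClosure k))
    [∀ i, FiniteDimensional k (K' i)]
    (γ : (Additive Gal(K₀/k) →+ AddCircle (1 : ℚ)) ≃+ ZMod (p ^ e)) :
    ∃ (ν : GalH1 k K₀ k ≃+ (Additive Gal(K₀/k) →+ AddCircle (1 : ℚ)))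
      (Φ : ∀ i, GalH1 k K₀ (K' i) ≃+ ZMod (p ^ globalExp p K₀ K' i)),
      (∀ x χ, CorrespondsTo K₀ x χ ↔ ν x = χ) ∧
      (∀ i x, Φ i (baseChange K₀ k (K' i) x) = proj (globalExp p K₀ K' i) (γ (ν x))) ∧
      ((selmerGroup k K₀ (fun i => K' i)).map (AddEquiv.piCongrRight Φ).toAddMonoidHom :
        Set (SumZMod p K₀ K')) = groupG p K₀ K' ∧
      ∀ a, a ∈ groupG p K₀ K' ↔ ∀ v, LocallyDiagonalAt a v := by
  have hcomm : IsMulCommutative Gal(K₀/k) := IsCyclic.isMulCommutative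
  let N := AddEquiv.ofBijective (theta K₀ k) ⟨theta_self_injective K₀, theta_surjective K₀ k⟩
  -- `theta` after `γ⁻¹` and reduction modulo `p^{e_i}` are two surjections from `ℤ/p^e` with the
  -- same kernel.
  have hΦ : ∀ i, ∃ Φ : GalH1 k K₀ (K' i) ≃+ ZMod (p ^ globalExp p K₀ K' i),
      ∀ n, Φ (theta K₀ (K' i) (γ.symm n)) = proj (globalExp p K₀ K' i) n := fun i => by
    have hle := globalExp_le (K' := K') hp hdeg i
    refine exists_addEquiv_of_ker_eq (f := (theta K₀ (K' i)).comp γ.symm.toAddMonoidHom)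
      (g := (ZMod.castHom (pow_dvd_pow p hle) (ZMod (p ^ globalExp p K₀ K' i))).toAddMonoidHom)
      ((theta_surjective K₀ (K' i)).comp γ.symm.surjective) (proj_surjective hle) fun n => ?_
    refine (theta_symm_eq_zero_iff hcyc hp hdeg γ (K' i) n).trans ?_
    rw [← globalExp_eq (K' := K') i]
    rfl
  choose Φ hΦ using hΦ
  refine ⟨N.symm, Φ, fun x χ => ?_, fun i x => ?_, ?_, fun a => ?_⟩
  · rw [correspondsTo_iff]
    exact N.symm_apply_eq.symm
  · obtain ⟨χ, rfl⟩ := N.surjective x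
    rw [N.symm_apply_apply, ← hΦ, γ.symm_apply_apply]
    exact congrArg (Φ i) (baseChange_theta K₀ k χ)
  · ext a
    -- Lifting each `a_i` to `ℤ/p^e` writes the preimage of `a` as a family of values of `theta`.
    choose A hA using fun i => proj_surjective (globalExp_le (K' := K') hp hdeg i) (a i)
    have hmem : a ∈ ((selmerGroup k K₀ (fun i => K' i)).map
        (AddEquiv.piCongrRight Φ).toAddMonoidHom : Set (SumZMod p K₀ K')) ↔
        (fun i => theta K₀ (K' i) (γ.symm (A i))) ∈ selmerGroup k K₀ (fun i => K' i) := by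
      have hx : AddEquiv.piCongrRight Φ (fun i => theta K₀ (K' i) (γ.symm (A i))) = a := by
        funext i
        exact (hΦ i (A i)).trans (hA i)
      constructor
      · rintro ⟨x, hx', h⟩
        rwa [← (AddEquiv.piCongrRight Φ).injective (h.trans hx.symm)]
      · exact fun h => ⟨_, h, hx⟩
    rw [hmem, mem_groupG_iff hp hdeg, theta_mem_selmerGroup_iff hcyc hp hdeg]
    refine forall_congr' fun v => exists_congr fun n => forall_congr' fun i =>
      forall_congr' fun w => ?_
    rw [← expOver_eq, ← hA i,
      proj_proj (globalExp_le hp hdeg i) (expOver_le_globalExp hp hdeg i w)]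
  · rw [mem_groupG_iff hp hdeg]
    exact forall_congr' fun v => (locallyDiagonalAt_iff hp hdeg a v).symm
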